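/- Let $k\ge 3$ be an integer and $\mathbb F\in\{\mathbb R,\mathbb C\}$. For $n\in\mathbb N$ let $K_n^k$ be the complete $k$-partite $k$-uniform hypergraph with vertex classes $V_1,\dots,V_k$ of size $n$ each; its $n^k$ edges are the elements of $V_1\times\dots\times V_k$. Order the edges of $K_n^k$ uniformly at random, let $G(n,m)$ be the spanning subgraph of $K_n^k$ formed by the first $m$ edges, and let $$M_1=\min\{m : \text{every vertex of } G(n,m) \text{ has degree at least } 1\}.$$ A spanning subgraph $G$ of $K_n^k$ is called globally rigid in $\mathbb F^1$ if the following holds for every $p\colon V_1\cup\dots\cup V_k\to\mathbb F$ whose values $p_v$ (indexed by all vertices $v$) are algebraically independent over $\mathbb Q$: every $q\colon V_1\cup\dots\cup V_k\to\mathbb F$ with $$\prod_{v\in e}q_v=\prod_{v\in e}p_v\qquad\text{for all edges } e \text{ of } G$$ is of the form $q_v=a_ip_v$ ($v\in V_i$, $1\le i\le k$) for some $a_1,\dots,a_k\in\mathbb F$ with $\prod_{i=1}^k a_i=1$. Then, for each $k\ge 3$ and each $\mathbb F\in\{\mathbb R,\mathbb C\}$, the random graph $G(n,M_1)$ is asymptotically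 almost surely globally rigid in $\mathbb F^1$, that is, $$\lim_{n\to\infty}\Pr\bigl[\,G(n,M_1)\text{ is globally rigid in }\mathbb F^1\,\bigr]=1 .$$ -/

import Mathlib

open scoped BigOperators Topology

namespace TensorRigidity

/-! ### `k`-partite `k`-graphs

A `k`-partite `k`-graph with vertex classes `V 0, …, V (k-1)` has vertex set `Σ i, V i`
(the disjoint union of the classes). An edge meets each class in exactly one vertex, so it is an
element of `Π i, V i`, and the graph is given by its edge set `E : Finset (∀ i, V i)`. -/

/-- The number of edges of `E` that contain the vertex `v`. -/
def degree {k : ℕ} {V : Fin k → Type*} [∀ i, DecidableEq (V i)]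
    (E : Finset (∀ i, V i)) (v : Σ i, V i) : ℕ :=
  (E.filter fun e => e v.1 = v.2).card

/-- A `d`-dimensional point configuration over `F`: a point of `F^d` for every vertex. -/
abbrev Config {k : ℕ} (F : Type*) (d : ℕ) (V : Fin k → Type*) : Type _ :=
  (Σ i, V i) → Fin d → F

/-- The rigidity map `f_G^d`, with
`f_G^d(p)_e = ∑ j, p_{e 0, j} * p_{e 1, j} * ⋯ * p_{e (k-1), j}` for `e ∈ E(G)`. -/
def rigidityMap {k : ℕ} {F : Type*} [Field F] {d : ℕ} {V : Fin k → Type*}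
    (E : Finset (∀ i, V i)) (p : Config F d V) : E → F :=
  fun e => ∑ j : Fin d, ∏ i : Fin k, p ⟨i, e.1 i⟩ j

/-- A tuple `(A_1, …, A_k)` in `GL(d, F)^k` is a stabilizer if `A_i = D_i Σ` for one permutation
matrix `Σ` and diagonal matrices `D_i` with product the identity matrix. -/
def IsStabilizer {k : ℕ} {F : Type*} [Field F] {d : ℕ}
    (A : Fin k → GL (Fin d) F) : Prop :=
  ∃ (σ : Equiv.Perm (Fin d)) (D : Fin k → Fin d → F),
    (∀ j, ∏ i, D i j = 1) ∧
    ∀ i, (A i : Matrix (Fin d) (Fin d) F) = Matrix.diagonal (D i) * σ.permMatrix F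

/-- `p` and `q` are congruent if some stabilizer maps `p` to `q`, where `(A_1, …, A_k)` acts by
`A_i` on the points of the vertices in the `i`-th class. -/
def Congruent {k : ℕ} {F : Type*} [Field F] {d : ℕ} {V : Fin k → Type*}
    (p q : Config F d V) : Prop :=
  ∃ A : Fin k → GL (Fin d) F, IsStabilizer A ∧
    ∀ v : Σ i, V i, q v = Matrix.mulVec (A v.1 : Matrix (Fin d) (Fin d) F) (p v)

/-- The framework `(G, p)` is globally rigid. -/
def FrameworkGloballyRigid {k : ℕ} {F : Type*} [Field F] {d : ℕ} {V : Fin k → Type*}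
    (E : Finset (∀ i, V i)) (p : Config F d V) : Prop :=
  ∀ q : Config F d V, rigidityMap E p = rigidityMap E q → Congruent p q

/-- A configuration is generic if all its coordinates are algebraically independent over `ℚ`. -/
def IsGeneric {k : ℕ} {F : Type*} [Field F] [Algebra ℚ F] {d : ℕ} {V : Fin k → Type*}
    (p : Config F d V) : Prop :=
  AlgebraicIndependent ℚ fun x : (Σ i, V i) × Fin d => p x.1 x.2

/-- `G` is globally rigid in `F^d`: every generic `d`-dimensional framework of `G` over `F` is
globally rigid. -/
def GloballyRigid {k : ℕ} (F : Type*) [Field F] [Algebra ℚ F] (d : ℕ) {V : Fin k → Type*}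
    (E : Finset (∀ i, V i)) : Prop :=
  ∀ p : Config F d V, IsGeneric p → FrameworkGloballyRigid E p

/-! ### The random graph process on the edges of `K_n^k` -/

/-- The edges of the balanced complete `k`-partite `k`-graph `K_n^k`. -/
abbrev Edge (k n : ℕ) : Type := Fin k → Fin n

/-- The sample space of the random graph process: the orderings of the `n ^ k` edges of `K_n^k`. -/
abbrev EdgeOrder (k n : ℕ) : Type := Fin (n ^ k) ≃ Edge k n

instance (k n : ℕ) : MeasurableSpace (EdgeOrder k n) := ⊤

/-- All orderings of the edges are equally likely. -/
noncomputable def processMeasure (k n : ℕ) : MeasureTheory.Measure (EdgeOrder k n) :=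
  ProbabilityTheory.uniformOn Set.univ

/-- `G(n, m)`: the first `m` edges of the random ordering `ω`. -/
def randomGraph {k n : ℕ} (ω : EdgeOrder k n) (m : ℕ) : Finset (Edge k n) :=
  (Finset.univ.filter fun j : Fin (n ^ k) => (j : ℕ) < m).map ω.toEmbedding

/-- `M_d = min {m : the minimum degree of G(n, m) is at least d}`. -/
noncomputable def hittingTime {k n : ℕ} (d : ℕ) (ω : EdgeOrder k n) : ℕ :=
  sInf {m : ℕ | ∀ v : Σ _ : Fin k, Fin n, d ≤ degree (randomGraph ω m) v}

end TensorRigidity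

/-! If `q` has the same edge products as a generic `p`, then x = q/p labels the vertices by units of
`F` with product 1 on every edge, and congruence says that x is constant on each class, with
constants of product 1. So the question is about labellings in an arbitrary abelian group.
Genericity is used only through p having no zero; q has none because every vertex is on an edge.

With high probability M₁ lies between m₀ ≈ (1 - δ) n log n and m₁ ≈ 2 n log n. There may be
infinitely many labellings, so a union bound over them is impossible. Instead, call an edge fresh if
trivial products on the preceding edges do not force a trivial product on it. Different sets of
fresh edges have different degree vectors, and counting these vectors leaves only O(n) fresh edges
(`card_freshIndices_le`). A union bound over their positions shows that a labelling trivial on m₀ ≫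
n random edges is trivial on all but a proportion ε of all edges (`card_spread_le`). Such a
labelling agrees with class constants of product 1 outside a set U of at most δn vertices
(`exists_majority_labels`).

An edge with exactly one vertex in U would force the right label on that vertex. Hence no edge of
G(n, M₁) meets U exactly once, while every vertex of U is covered, so it is covered by an edge with
a second vertex in U. A nonempty set of this kind is unlikely to exist (`stuck_bound`).

All counts are made for independent uniform edges. Passing to the random ordering costs a factor 2,
because m₁² is small against n^k when k ≥ 3. -/

namespace TensorRigidity

/-- The vertices of `K_n^k`. -/
abbrev Vertex (k n : ℕ) : Type := Σ _ : Fin k, Fin n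

/-- The number of vertices of `U` on the edge `e`. -/
def hits {k n : ℕ} (U : Finset (Vertex k n)) (e : Edge k n) : ℕ :=
  (U.filter fun v => e v.1 = v.2).card

/-! ### Moments of the number of vertices of `U` on a uniform edge -/

section EdgeCounting

variable {k n : ℕ}

/-- Resampling one coordinate preserves the uniform distribution: swapping `e i` with the new value
is an involution on pairs. -/
theorem sum_sum_update (i : Fin k) (f : Edge k n → ℝ) :
    ∑ e : Edge k n, ∑ a : Fin n, f (Function.update e i a) = n * ∑ e, f e := by
  have hinv : Function.Involutive
      (fun z : Edge k n × Fin n => ((Function.update z.1 i z.2, z.1 i) : Edge k n × Fin n)) := by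
    rintro ⟨e, a⟩
    simp
  rw [← Fintype.sum_prod_type' (f := fun (e : Edge k n) (a : Fin n) => f (Function.update e i a))]
  refine (Equiv.sum_comp hinv.toPerm (fun z : Edge k n × Fin n => f z.1)).trans ?_
  rw [Fintype.sum_prod_type]
  simp [Finset.mul_sum]

theorem sum_edge_through (v : Vertex k n) :
    (n : ℝ) * ∑ e : Edge k n, (if e v.1 = v.2 then (1 : ℝ) else 0) = (n : ℝ) ^ k := by
  rw [← sum_sum_update v.1]
  simp

theorem sum_edge_through_pair {v w : Vertex k n} (h : v ≠ w) :
    (n : ℝ) ^ 2 * ∑ e : Edge k n, (if e v.1 = v.2 then (1 : ℝ) else 0) *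
      (if e w.1 = w.2 then (1 : ℝ) else 0) ≤ (n : ℝ) ^ k := by
  by_cases hc : v.1 = w.1
  · have h0 : ∀ e : Edge k n, (if e v.1 = v.2 then (1 : ℝ) else 0) *
        (if e w.1 = w.2 then (1 : ℝ) else 0) = 0 := by
      intro e
      obtain ⟨i, a⟩ := v
      obtain ⟨j, b⟩ := w
      dsimp only at hc
      subst hc
      by_cases h1 : e i = a
      · have : e i ≠ b := by
          rintro rfl
          exact h (by rw [h1])
        simp [this]
      · simp [h1]
    simp only [h0, Finset.sum_const_zero, mul_zero]
    positivity
  · have hne : w.1 ≠ v.1 := fun h' => hc h'.symm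
    rw [pow_two, mul_assoc, ← sum_sum_update v.1, ← sum_edge_through w]
    simp [Function.update_of_ne hne]

theorem hits_eq_sum (U : Finset (Vertex k n)) (e : Edge k n) :
    (hits U e : ℝ) = ∑ v ∈ U, if e v.1 = v.2 then (1 : ℝ) else 0 := by
  simp [hits]

theorem sum_hits (U : Finset (Vertex k n)) :
    (n : ℝ) * ∑ e : Edge k n, (hits U e : ℝ) = U.card * (n : ℝ) ^ k := by
  simp_rw [hits_eq_sum]
  rw [Finset.sum_comm, Finset.mul_sum]
  simp_rw [sum_edge_through]
  simp

/-- Second factorial moment: two different vertices lie on a common edge with probability 1/n² if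
their classes differ, and never otherwise. -/
theorem sum_hits_mul_pred (U : Finset (Vertex k n)) :
    (n : ℝ) ^ 2 * ∑ e : Edge k n, (hits U e : ℝ) * (hits U e - 1) ≤
      (U.card : ℝ) ^ 2 * (n : ℝ) ^ k := by
  have h1 : ∀ e : Edge k n, (hits U e : ℝ) * (hits U e - 1) =
      ∑ v ∈ U, ∑ w ∈ U, if v = w then 0 else (if e v.1 = v.2 then (1 : ℝ) else 0) *
        (if e w.1 = w.2 then (1 : ℝ) else 0) := by
    intro e
    have h2 : ∀ v ∈ U, (∑ w ∈ U, if v = w then 0 else (if e v.1 = v.2 then (1 : ℝ) else 0) *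
        (if e w.1 = w.2 then (1 : ℝ) else 0)) =
        (if e v.1 = v.2 then (1 : ℝ) else 0) * (hits U e - 1) := by
      intro v hv
      rw [hits_eq_sum, ← Finset.add_sum_erase U _ hv, ← Finset.add_sum_erase U _ hv]
      simp only [if_true, zero_add]
      have h3 : ∀ w ∈ U.erase v, (if v = w then 0 else (if e v.1 = v.2 then (1 : ℝ) else 0) *
          (if e w.1 = w.2 then (1 : ℝ) else 0)) = (if e v.1 = v.2 then (1 : ℝ) else 0) *
          (if e w.1 = w.2 then (1 : ℝ) else 0) := by
        intro w hw
        rw [if_neg (Finset.ne_of_mem_erase hw).symm]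
      rw [Finset.sum_congr rfl h3, ← Finset.mul_sum]
      split_ifs <;> simp
    rw [Finset.sum_congr rfl h2, ← Finset.sum_mul, hits_eq_sum]
  simp_rw [h1]
  rw [Finset.sum_comm, Finset.mul_sum]
  have h4 : ∀ v ∈ U, (n : ℝ) ^ 2 * ∑ e : Edge k n, ∑ w ∈ U, (if v = w then 0 else
      (if e v.1 = v.2 then (1 : ℝ) else 0) * (if e w.1 = w.2 then (1 : ℝ) else 0)) ≤
      U.card * (n : ℝ) ^ k := by
    intro v _
    rw [Finset.sum_comm, Finset.mul_sum, ← nsmul_eq_mul]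
    refine Finset.sum_le_card_nsmul _ _ _ fun w _ => ?_
    by_cases h : v = w
    · simp only [h, if_true, Finset.sum_const_zero, mul_zero]
      positivity
    · simp only [h, if_false]
      exact sum_edge_through_pair h
  calc _ ≤ ∑ v ∈ U, U.card * (n : ℝ) ^ k := Finset.sum_le_sum h4
    _ = _ := by simp; ring

/-- A Chernoff-type bound for the number of sequences of `m` edges. -/
theorem mul_card_le_prod_sum {E ι : Type*} [Fintype E] [Fintype ι] [DecidableEq ι]
    (B : Finset (ι → E)) (c : ℝ) (g : ι → E → ℝ) (hg : ∀ j e, 0 ≤ g j e)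
    (hB : ∀ s ∈ B, c ≤ ∏ j, g j (s j)) :
    c * B.card ≤ ∏ j, ∑ e, g j e := by
  classical
  rw [Finset.prod_univ_sum, Fintype.piFinset_univ, mul_comm, ← nsmul_eq_mul]
  calc B.card • c ≤ ∑ s ∈ B, ∏ j, g j (s j) := Finset.card_nsmul_le_sum _ _ _ hB
    _ ≤ _ := Finset.sum_le_sum_of_subset_of_nonneg (Finset.subset_univ _)
      fun s _ _ => Finset.prod_nonneg fun j _ => hg j _

end EdgeCounting

/-! ### Isolated vertices: first and second moments -/

section Moments

variable {k n : ℕ}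

/-- The sequence `s` of edges has no edge through `v`. -/
def Misses {m : ℕ} (s : Fin m → Edge k n) (v : Vertex k n) : Prop := ∀ j, s j v.1 ≠ v.2

instance {m : ℕ} (s : Fin m → Edge k n) (v : Vertex k n) : Decidable (Misses s v) := by
  unfold Misses; infer_instance

theorem sum_edge_avoiding (hn : 0 < n) (v : Vertex k n) :
    ∑ e : Edge k n, (if e v.1 ≠ v.2 then (1 : ℝ) else 0) = (n : ℝ) ^ k * (1 - 1 / n) := by
  have hn' : (n : ℝ) ≠ 0 := by positivity
  have h1 := sum_edge_through v
  have h2 : ∀ e : Edge k n, (if e v.1 ≠ v.2 then (1 : ℝ) else 0) =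
      1 - (if e v.1 = v.2 then (1 : ℝ) else 0) := by
    intro e; split_ifs <;> simp_all
  simp_rw [h2]
  rw [Finset.sum_sub_distrib]
  have h3 : ∑ e : Edge k n, (if e v.1 = v.2 then (1 : ℝ) else 0) = (n : ℝ) ^ k / n := by
    field_simp; linarith
  rw [h3]
  simp
  ring

theorem sum_edge_avoiding_pair (hn : 0 < n) (i : Fin k) {a b : Fin n} (h : a ≠ b) :
    ∑ e : Edge k n, (if e i ≠ a then (1 : ℝ) else 0) * (if e i ≠ b then (1 : ℝ) else 0) =
      (n : ℝ) ^ k * (1 - 2 / n) := by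
  have hn' : (n : ℝ) ≠ 0 := by positivity
  have h3 : ∀ a : Fin n, ∑ e : Edge k n, (if e i = a then (1 : ℝ) else 0) = (n : ℝ) ^ k / n := by
    intro a
    have h1 := sum_edge_through (⟨i, a⟩ : Vertex k n)
    dsimp only at h1
    field_simp; linarith
  have h2 : ∀ e : Edge k n, (if e i ≠ a then (1 : ℝ) else 0) * (if e i ≠ b then (1 : ℝ) else 0) =
      1 - (if e i = a then (1 : ℝ) else 0) - (if e i = b then (1 : ℝ) else 0) := by
    intro e; split_ifs <;> simp_all
  simp_rw [h2]
  rw [Finset.sum_sub_distrib, Finset.sum_sub_distrib, h3, h3]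
  simp
  ring

theorem sum_misses (hn : 0 < n) (m : ℕ) (v : Vertex k n) :
    ∑ s : Fin m → Edge k n, (if Misses s v then (1 : ℝ) else 0) =
      ((n : ℝ) ^ k) ^ m * (1 - 1 / n) ^ m := by
  rw [← mul_pow, ← sum_edge_avoiding hn v, Fintype.sum_pow]
  refine Finset.sum_congr rfl fun s _ => ?_
  rw [Finset.prod_ite_zero]
  simp [Misses]

theorem sum_misses_pair (hn : 0 < n) (m : ℕ) (i : Fin k) {a b : Fin n} (h : a ≠ b) :
    ∑ s : Fin m → Edge k n, (if Misses s ⟨i, a⟩ then (1 : ℝ) else 0) *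
      (if Misses s ⟨i, b⟩ then (1 : ℝ) else 0) = ((n : ℝ) ^ k) ^ m * (1 - 2 / n) ^ m := by
  rw [← mul_pow, ← sum_edge_avoiding_pair hn i h, Fintype.sum_pow]
  refine Finset.sum_congr rfl fun s _ => ?_
  rw [Finset.prod_mul_distrib, Finset.prod_ite_zero, Finset.prod_ite_zero]
  simp only [Misses, Finset.mem_univ, true_imp_iff, Finset.prod_const_one]

/-- First moment bound for isolated vertices. -/
theorem card_exists_misses_le (hn : 0 < n) (m : ℕ) :
    ((Finset.univ.filter fun s : Fin m → Edge k n => ∃ v, Misses s v).card : ℝ) ≤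
      ((n : ℝ) ^ k) ^ m * (n * k * (1 - 1 / n) ^ m) := by
  classical
  have h1 : (Finset.univ.filter fun s : Fin m → Edge k n => ∃ v, Misses s v) ⊆
      Finset.univ.biUnion fun v : Vertex k n =>
        Finset.univ.filter fun s : Fin m → Edge k n => Misses s v := by
    intro s; simp
  have h2 := (Finset.card_le_card h1).trans Finset.card_biUnion_le
  have h3 : ((Finset.univ.filter fun s : Fin m → Edge k n => ∃ v, Misses s v).card : ℝ) ≤
      ∑ v : Vertex k n, ((Finset.univ.filter fun s : Fin m → Edge k n => Misses s v).card : ℝ) := by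
    exact_mod_cast h2
  refine h3.trans (le_of_eq ?_)
  have h4 : ∀ v : Vertex k n,
      ((Finset.univ.filter fun s : Fin m → Edge k n => Misses s v).card : ℝ) =
      ((n : ℝ) ^ k) ^ m * (1 - 1 / n) ^ m := by
    intro v
    rw [← sum_misses hn m v]
    simp
  simp_rw [h4]
  simp
  ring

/-- Second moment bound: few short sequences cover a vertex class. -/
theorem card_covers_class_le (hn : 2 ≤ n) (m : ℕ) (i : Fin k) :
    ((Finset.univ.filter fun s : Fin m → Edge k n => ∀ a, ¬ Misses s ⟨i, a⟩).card : ℝ) *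
      (n * (1 - 1 / n) ^ m) ≤ ((n : ℝ) ^ k) ^ m := by
  have hn0 : 0 < n := by omega
  have hnR : (2 : ℝ) ≤ n := by exact_mod_cast hn
  set b : ℝ := (1 - 1 / n) ^ m with hb
  set P : ℝ := ((n : ℝ) ^ k) ^ m with hP
  have hbase : 0 < 1 - 1 / (n : ℝ) := by
    rw [sub_pos, div_lt_one (by linarith)]; linarith
  have hb0 : 0 < b := pow_pos hbase m
  have hP0 : 0 < P := by positivity
  set X : (Fin m → Edge k n) → ℝ := fun s => ∑ a, if Misses s ⟨i, a⟩ then (1 : ℝ) else 0 with hX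
  have hEX : ∑ s, X s = P * (n * b) := by
    simp only [hX]
    rw [Finset.sum_comm]
    simp_rw [sum_misses hn0]
    simp [hb, hP]; ring
  -- Being missed is negatively correlated within a class, so the variance is at most the mean and
  -- Chebyshev applies.
  have hpow : (1 - 2 / (n : ℝ)) ^ m ≤ b ^ 2 := by
    rw [hb, ← pow_mul, mul_comm m 2, pow_mul]
    refine pow_le_pow_left₀ ?_ ?_ m
    · rw [sub_nonneg, div_le_one (by linarith)]; exact hnR
    · have : (1 - 1 / (n : ℝ)) ^ 2 = 1 - 2 / n + (1 / n) ^ 2 := by ring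
      rw [this]
      nlinarith [sq_nonneg (1 / (n : ℝ))]
  have hEX2 : ∑ s, X s ^ 2 ≤ P * (n * b + n ^ 2 * b ^ 2) := by
    have h1 : ∀ s, X s ^ 2 = ∑ a, ∑ c, (if Misses s ⟨i, a⟩ then (1 : ℝ) else 0) *
        (if Misses s ⟨i, c⟩ then (1 : ℝ) else 0) := by
      intro s; rw [pow_two, Finset.sum_mul_sum]
    simp_rw [h1]
    rw [Finset.sum_comm]
    have h2 : ∀ a : Fin n, ∑ s : Fin m → Edge k n, ∑ c, (if Misses s ⟨i, a⟩ then (1 : ℝ) else 0) *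
        (if Misses s ⟨i, c⟩ then (1 : ℝ) else 0) ≤ P * b + n * (P * b ^ 2) := by
      intro a
      rw [Finset.sum_comm, ← Finset.add_sum_erase _ _ (Finset.mem_univ a)]
      refine add_le_add ?_ ?_
      · rw [hP, hb, ← sum_misses hn0 m ⟨i, a⟩]
        refine le_of_eq (Finset.sum_congr rfl fun s _ => ?_)
        split_ifs <;> simp
      · calc _ ≤ ∑ c ∈ Finset.univ.erase a, P * b ^ 2 := by
              refine Finset.sum_le_sum fun c hc => ?_
              rw [sum_misses_pair hn0 m i (Finset.ne_of_mem_erase hc).symm]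
              exact mul_le_mul_of_nonneg_left hpow hP0.le
          _ ≤ ∑ c : Fin n, P * b ^ 2 :=
              Finset.sum_le_sum_of_subset_of_nonneg (Finset.subset_univ _)
                fun _ _ _ => by positivity
          _ = _ := by simp
    calc _ ≤ ∑ a : Fin n, (P * b + n * (P * b ^ 2)) := Finset.sum_le_sum fun a _ => h2 a
      _ = _ := by simp; ring
  set Z := Finset.univ.filter fun s : Fin m → Edge k n => ∀ a, ¬ Misses s ⟨i, a⟩ with hZ
  have hvar : ∑ s, (X s - n * b) ^ 2 ≤ P * (n * b) := by
    have h1 : ∀ s, (X s - n * b) ^ 2 = X s ^ 2 - 2 * (n * b) * X s + (n * b) ^ 2 := by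
      intro s; ring
    simp_rw [h1]
    rw [Finset.sum_add_distrib, Finset.sum_sub_distrib, ← Finset.mul_sum, hEX]
    have h2 : ∑ _s : Fin m → Edge k n, ((n : ℝ) * b) ^ 2 = P * (n * b) ^ 2 := by
      simp [hP]
    rw [h2]
    nlinarith
  have hlow : (Z.card : ℝ) * (n * b) ^ 2 ≤ ∑ s, (X s - n * b) ^ 2 := by
    calc (Z.card : ℝ) * (n * b) ^ 2 = ∑ s ∈ Z, (X s - n * b) ^ 2 := by
          rw [← nsmul_eq_mul, ← Finset.sum_const]
          refine Finset.sum_congr rfl fun s hs => ?_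
          have : X s = 0 := by
            simp only [hX]
            refine Finset.sum_eq_zero fun a _ => ?_
            rw [if_neg ((Finset.mem_filter.1 hs).2 a)]
          rw [this]; ring
      _ ≤ _ := Finset.sum_le_sum_of_subset_of_nonneg (Finset.subset_univ _)
          fun _ _ _ => sq_nonneg _
  have hpos : 0 < n * b := by positivity
  have := hlow.trans hvar
  refine le_of_mul_le_mul_right ?_ hpos
  calc _ = (Z.card : ℝ) * (n * b) ^ 2 := by ring
    _ ≤ _ := this

end Moments

/-! ### Closure of edge sets under forced triviality; few fresh edges -/

section Closure

variable {k n : ℕ} {A : Type*} [CommGroup A]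

/-- The product of the labels of the vertices of `e`. -/
def edgeProd (x : Vertex k n → A) (e : Edge k n) : A := ∏ i, x ⟨i, e i⟩

/-- The edges `e` such that every labelling with trivial product on the edges in `T` has
trivial product on `e`. -/
def edgeClosure (A : Type*) [CommGroup A] (T : Set (Edge k n)) : Set (Edge k n) :=
  {e | ∀ x : Vertex k n → A, (∀ f ∈ T, edgeProd x f = 1) → edgeProd x e = 1}

theorem subset_edgeClosure (T : Set (Edge k n)) : T ⊆ edgeClosure A T :=
  fun e he _ hx => hx e he

theorem edgeProd_eq_prod_pow (x : Vertex k n → A) (e : Edge k n) :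
    edgeProd x e = ∏ v : Vertex k n, x v ^ (if e v.1 = v.2 then 1 else 0) := by
  rw [Fintype.prod_sigma]
  refine Finset.prod_congr rfl fun i _ => ?_
  simp [pow_ite]

theorem prod_edgeProd_eq {ι : Type*} (x : Vertex k n → A) (s : ι → Edge k n) (T : Finset ι) :
    ∏ j ∈ T, edgeProd x (s j) =
      ∏ v : Vertex k n, x v ^ (T.filter fun j => s j v.1 = v.2).card := by
  simp_rw [edgeProd_eq_prod_pow]
  rw [Finset.prod_comm]
  refine Finset.prod_congr rfl fun v _ => ?_
  rw [Finset.prod_pow_eq_pow_sum, Finset.card_filter]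

open Classical in
/-- The indices of the edges that are not in the closure of the preceding ones. -/
noncomputable def freshIndices (A : Type*) [CommGroup A] {m : ℕ} (s : Fin m → Edge k n) :
    Finset (Fin m) :=
  Finset.univ.filter fun j => s j ∉ edgeClosure A (s '' {i | i < j})

/-- The fresh edges play the role of a greedily chosen basis; a non-fresh edge is forced by earlier
edges, which are forced by induction. -/
theorem mem_edgeClosure_freshIndices {m : ℕ} (s : Fin m → Edge k n) (j : Fin m) :
    s j ∈ edgeClosure A (s '' (freshIndices A s : Set (Fin m))) := by
  induction j using WellFoundedLT.induction with
  | _ j ih =>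
    by_cases hj : j ∈ freshIndices A s
    · exact subset_edgeClosure _ ⟨j, hj, rfl⟩
    · have h1 : s j ∈ edgeClosure A (s '' {i | i < j}) := by
        by_contra h
        exact hj (by simp [freshIndices, h])
      intro x hx
      refine h1 x ?_
      rintro _ ⟨i, hi, rfl⟩
      exact ih i hi x hx

/-- Sums of different sets of fresh edges are different. -/
theorem degree_vector_injOn {m : ℕ} (s : Fin m → Edge k n) :
    Set.InjOn (fun (T : Finset (Fin m)) (v : Vertex k n) => (T.filter fun j => s j v.1 = v.2).card)
      ((freshIndices A s).powerset : Set (Finset (Fin m))) := by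
  classical
  intro T₁ h₁ T₂ h₂ h
  simp only [Finset.coe_powerset, Set.mem_preimage, Set.mem_powerset_iff, Finset.coe_subset] at h₁ h₂
  by_contra hne
  have hD : (symmDiff T₁ T₂).Nonempty := by
    rw [Finset.nonempty_iff_ne_empty]
    simpa [Finset.symmDiff_eq_empty] using hne
  -- Equal degree vectors give equal products over `T₁` and `T₂`. At the last index where the sets
  -- differ, this equation makes the edge a consequence of earlier ones, so it is not fresh.
  obtain ⟨j, hj, hmax⟩ := (symmDiff T₁ T₂).exists_max_image id hD
  have hjS : j ∈ freshIndices A s := by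
    rcases Finset.mem_symmDiff.1 hj with h | h
    · exact h₁ h.1
    · exact h₂ h.1
  refine (Finset.mem_filter.1 hjS).2 fun x hx => ?_
  have hlt : ∀ i ∈ symmDiff T₁ T₂, i ≠ j → edgeProd x (s i) = 1 := fun i hi hij =>
    hx _ ⟨i, lt_of_le_of_ne (hmax i hi) hij, rfl⟩
  have hprod : ∏ i ∈ T₁, edgeProd x (s i) = ∏ i ∈ T₂, edgeProd x (s i) := by
    rw [prod_edgeProd_eq, prod_edgeProd_eq]
    refine Finset.prod_congr rfl fun v _ => ?_
    rw [show (T₁.filter fun j => s j v.1 = v.2).card = (T₂.filter fun j => s j v.1 = v.2).card from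
      congrFun h v]
  rw [← Finset.prod_inter_mul_prod_sdiff T₁ T₂, ← Finset.prod_inter_mul_prod_sdiff T₂ T₁,
    Finset.inter_comm T₂ T₁, mul_right_inj] at hprod
  rcases Finset.mem_symmDiff.1 hj with h | h
  · have hA : ∏ i ∈ T₁ \ T₂, edgeProd x (s i) = edgeProd x (s j) :=
      Finset.prod_eq_single_of_mem j (Finset.mem_sdiff.2 h) fun i hi hij =>
        hlt i (Finset.mem_symmDiff.2 (Or.inl (Finset.mem_sdiff.1 hi))) hij
    have hB : ∏ i ∈ T₂ \ T₁, edgeProd x (s i) = 1 :=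
      Finset.prod_eq_one fun i hi =>
        hlt i (Finset.mem_symmDiff.2 (Or.inr (Finset.mem_sdiff.1 hi))) fun hij =>
          (Finset.mem_sdiff.1 hi).2 (hij ▸ h.1)
    rw [← hA, hprod, hB]
  · have hA : ∏ i ∈ T₂ \ T₁, edgeProd x (s i) = edgeProd x (s j) :=
      Finset.prod_eq_single_of_mem j (Finset.mem_sdiff.2 h) fun i hi hij =>
        hlt i (Finset.mem_symmDiff.2 (Or.inr (Finset.mem_sdiff.1 hi))) hij
    have hB : ∏ i ∈ T₁ \ T₂, edgeProd x (s i) = 1 :=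
      Finset.prod_eq_one fun i hi =>
        hlt i (Finset.mem_symmDiff.2 (Or.inl (Finset.mem_sdiff.1 hi))) fun hij =>
          (Finset.mem_sdiff.1 hi).2 (hij ▸ h.1)
    rw [← hA, ← hprod, hB]

theorem sum_card_through {ι : Type*} (s : ι → Edge k n) (T : Finset ι) :
    ∑ v : Vertex k n, (T.filter fun j => s j v.1 = v.2).card = k * T.card := by
  simp_rw [Finset.card_filter]
  rw [Finset.sum_comm]
  have h : ∀ e : Edge k n, ∑ v : Vertex k n, (if e v.1 = v.2 then 1 else 0) = k := by
    intro e
    rw [Fintype.sum_sigma]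
    simp
  simp_rw [h]
  simp [mul_comm]

/-- The 2^|S| subsets of the fresh set S have different degree vectors, each bounded coordinatewise
by the degrees d of S. Since d sums to k|S| over only kn vertices, ∏ (d v + 1) can reach 2^|S| only
if |S| = O(n). -/
theorem card_freshIndices_le (hk : 0 < k) {m : ℕ} (s : Fin m → Edge k n) :
    ((freshIndices A s).card : ℝ) ≤ 4 * k * Real.log (4 * k) * n := by
  classical
  set S := freshIndices A s with hS
  set d : Vertex k n → ℕ := fun v => (S.filter fun j => s j v.1 = v.2).card with hd
  have hkR : (0 : ℝ) < k := by exact_mod_cast hk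
  have h1 : 2 ^ S.card ≤ ∏ v, (d v + 1) := by
    have : S.powerset.card ≤ (Fintype.piFinset fun v => Finset.range (d v + 1)).card := by
      refine Finset.card_le_card_of_injOn _ (fun T hT => ?_) (degree_vector_injOn (A := A) s)
      simp only [Finset.coe_powerset, Set.mem_preimage, Set.mem_powerset_iff,
        Finset.coe_subset] at hT
      simp only [Finset.mem_coe, Fintype.mem_piFinset, Finset.mem_range, Nat.lt_succ_iff]
      intro v
      exact Finset.card_le_card (Finset.filter_subset_filter _ hT)
    simpa [Finset.card_powerset, Fintype.card_piFinset] using this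
  -- The scale 4k makes the exponentials multiply to e^(|S|/4), which loses to 2^|S| because 1/4 <
  -- log 2.
  have h2 : ∀ v, ((d v : ℝ) + 1) ≤ 4 * k * Real.exp (d v / (4 * k)) := by
    intro v
    have h3 := Real.add_one_le_exp ((d v : ℝ) / (4 * k))
    have hk1 : (1 : ℝ) ≤ k := by exact_mod_cast hk
    calc (d v : ℝ) + 1 ≤ 4 * k * (d v / (4 * k) + 1) := by field_simp; linarith
      _ ≤ _ := by gcongr
  have h4 : (2 : ℝ) ^ S.card ≤ (4 * k) ^ (k * n) * Real.exp (S.card / 4) := by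
    calc (2 : ℝ) ^ S.card ≤ ∏ v, ((d v : ℝ) + 1) := by exact_mod_cast h1
      _ ≤ ∏ v, (4 * k * Real.exp (d v / (4 * k))) :=
          Finset.prod_le_prod (fun _ _ => by positivity) fun v _ => h2 v
      _ = _ := by
          rw [Finset.prod_mul_distrib, ← Real.exp_sum, ← Finset.sum_div]
          have h5 : ∑ v, (d v : ℝ) = k * S.card := by exact_mod_cast sum_card_through s S
          rw [h5]
          congr 1
          · simp
          · congr 1; field_simp
  have h6 := Real.log_le_log (by positivity) h4
  rw [Real.log_mul (by positivity) (by positivity), Real.log_pow, Real.log_pow, Real.log_exp] at h6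
  have h7 := Real.log_two_gt_d9
  push_cast at h6
  nlinarith

end Closure

/-! ### From trivial products on a random sequence to almost constant labels -/

section Spread

variable {k n : ℕ} {A : Type*} [CommGroup A]

/-- The edges on which `x` has trivial product. -/
def trivialEdges (x : Vertex k n → A) : Set (Edge k n) := {e | edgeProd x e = 1}

open Classical in
-- The closure depends only on the edges at positions in `S`. Once these are fixed, the other m -
-- |S| edges independently have to fall into a set of density at most 1 - ε.
theorem card_generated_le (ε : ℝ) (hε : ε ≤ 1) {m : ℕ} (S : Finset (Fin m)) :
    ((Finset.univ.filter fun s : Fin m → Edge k n =>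
      ((edgeClosure A (s '' (S : Set (Fin m)))).ncard : ℝ) ≤ (1 - ε) * (n : ℝ) ^ k ∧
      ∀ j, s j ∈ edgeClosure A (s '' (S : Set (Fin m)))).card : ℝ) ≤
      ((n : ℝ) ^ k) ^ m * (1 - ε) ^ (m - S.card) := by
  set N : ℝ := (n : ℝ) ^ k with hN
  set B := Finset.univ.filter fun s : Fin m → Edge k n =>
      ((edgeClosure A (s '' (S : Set (Fin m)))).ncard : ℝ) ≤ (1 - ε) * N ∧
      ∀ j, s j ∈ edgeClosure A (s '' (S : Set (Fin m))) with hB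
  -- Replacing a too large closure by `∅` makes the size bound hold for every `t`.
  let C : ({j // j ∈ S} → Edge k n) → Finset (Edge k n) := fun t =>
    if ((edgeClosure A (Set.range t)).ncard : ℝ) ≤ (1 - ε) * N then
      Finset.univ.filter fun e => e ∈ edgeClosure A (Set.range t) else ∅
  have hC : ∀ t, ((C t).card : ℝ) ≤ (1 - ε) * N := by
    intro t
    simp only [C]
    split_ifs with h
    · refine le_trans (le_of_eq ?_) h
      rw [Set.ncard_eq_toFinset_card']
      congr 2
      ext e; simp
    · simp only [Finset.card_empty, Nat.cast_zero]
      exact mul_nonneg (by linarith) (by positivity)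
  let D : Finset (({j // j ∈ S} → Edge k n) × ({j // ¬ j ∈ S} → Edge k n)) :=
    Finset.univ.filter fun z => ∀ j, z.2 j ∈ C z.1
  have h1 : B.card ≤ D.card := by
    refine Finset.card_le_card_of_injOn
      (Equiv.piEquivPiSubtypeProd (fun j => j ∈ S) fun _ => Edge k n) ?_
      (Equiv.injective _).injOn
    intro s hs
    have hs' := (Finset.mem_filter.1 (Finset.mem_coe.1 hs)).2
    have hr : Set.range (fun j : {j // j ∈ S} => s j) = s '' (S : Set (Fin m)) := by
      ext e; simp
    simp only [D, Finset.coe_filter, Finset.mem_univ, true_and, Set.mem_ofPred_eq,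
      Equiv.piEquivPiSubtypeProd_apply, C, hr, hs'.1, if_true, Finset.mem_filter]
    exact fun j => hs'.2 j
  have h2 : (D.card : ℝ) = ∑ t, ((C t).card : ℝ) ^ (m - S.card) := by
    have h3 : D = (Finset.univ.sigma
        (fun t => Fintype.piFinset fun _ : {j // ¬ j ∈ S} => C t)).map
        (Equiv.sigmaEquivProd _ _).toEmbedding := by
      ext ⟨t, r⟩
      simp [D, Fintype.mem_piFinset]
    rw [h3, Finset.card_map, Finset.card_sigma]
    push_cast
    refine Finset.sum_congr rfl fun t _ => ?_
    rw [Fintype.card_piFinset]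
    simp [Fintype.card_subtype_compl]
  have hSm : S.card ≤ m := by simpa using S.card_le_univ
  calc (B.card : ℝ) ≤ D.card := by exact_mod_cast h1
    _ = ∑ t, ((C t).card : ℝ) ^ (m - S.card) := h2
    _ ≤ ∑ _t : {j // j ∈ S} → Edge k n, ((1 - ε) * N) ^ (m - S.card) :=
        Finset.sum_le_sum fun t _ => pow_le_pow_left₀ (by positivity) (hC t) _
    _ = N ^ S.card * ((1 - ε) * N) ^ (m - S.card) := by simp [hN]
    _ = N ^ m * (1 - ε) ^ (m - S.card) := by
        rw [mul_pow, mul_left_comm, ← pow_add, Nat.add_sub_cancel' hSm, mul_comm]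

open Classical in
/-- Few sequences of edges admit a labelling with trivial products on the sequence but
non-trivial products on a positive proportion of all edges. -/
theorem card_spread_le (hk : 0 < k) {ε : ℝ} (hε0 : 0 < ε) (hε : ε ≤ 1) (m : ℕ) :
    ((Finset.univ.filter fun s : Fin m → Edge k n => ∃ x : Vertex k n → A,
      (∀ j, edgeProd x (s j) = 1) ∧
        ((trivialEdges x).ncard : ℝ) ≤ (1 - ε) * (n : ℝ) ^ k).card : ℝ) ≤
      ((n : ℝ) ^ k) ^ m *
        ((2 / ε) ^ ⌊4 * k * Real.log (4 * k) * n⌋₊ * (1 - ε / 2) ^ m) := by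
  set L := ⌊4 * k * Real.log (4 * k) * n⌋₊ with hL
  set N : ℝ := (n : ℝ) ^ k with hN
  let G : Finset (Fin m) → Finset (Fin m → Edge k n) := fun S =>
    Finset.univ.filter fun s : Fin m → Edge k n =>
      ((edgeClosure A (s '' (S : Set (Fin m)))).ncard : ℝ) ≤ (1 - ε) * N ∧
      ∀ j, s j ∈ edgeClosure A (s '' (S : Set (Fin m)))
  have h1 : (Finset.univ.filter fun s : Fin m → Edge k n => ∃ x : Vertex k n → A,
      (∀ j, edgeProd x (s j) = 1) ∧ ((trivialEdges x).ncard : ℝ) ≤ (1 - ε) * N) ⊆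
      ((Finset.univ.filter fun S : Finset (Fin m) => S.card ≤ L).biUnion G) := by
    intro s hs
    obtain ⟨x, hx, hcard⟩ := (Finset.mem_filter.1 hs).2
    simp only [Finset.mem_biUnion, Finset.mem_filter, Finset.mem_univ, true_and, G]
    refine ⟨freshIndices A s, Nat.le_floor (card_freshIndices_le hk s), le_trans ?_ hcard,
      mem_edgeClosure_freshIndices s⟩
    have : edgeClosure A (s '' (freshIndices A s : Set (Fin m))) ⊆ trivialEdges x := by
      intro e he
      refine he x ?_
      rintro _ ⟨j, _, rfl⟩
      exact hx j
    exact_mod_cast Set.ncard_le_ncard this (Set.toFinite _)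
  have h2 := (Finset.card_le_card h1).trans Finset.card_biUnion_le
  have hz1 : 1 ≤ 2 / ε := by rw [le_div_iff₀ hε0]; linarith
  have hz : (2 / ε) * (ε / 2) = 1 := by field_simp
  have h3 : ∀ S ∈ (Finset.univ.filter fun S : Finset (Fin m) => S.card ≤ L),
      ((G S).card : ℝ) ≤ N ^ m * (2 / ε) ^ L * ((ε / 2) ^ S.card * (1 - ε) ^ (m - S.card)) := by
    intro S hS
    refine (card_generated_le ε hε S).trans ?_
    -- This factor replaces the restriction |S| ≤ L by a weight. The sum over all S is then binomial
    -- and gives (ε/2 + 1 - ε)^m.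
    have h4 : 1 ≤ (2 / ε) ^ L * (ε / 2) ^ S.card := by
      calc (1 : ℝ) = (2 / ε) ^ S.card * (ε / 2) ^ S.card := by rw [← mul_pow, hz, one_pow]
        _ ≤ _ := by
          gcongr
          exact (Finset.mem_filter.1 hS).2
    have h5 : 0 ≤ N ^ m * (1 - ε) ^ (m - S.card) :=
      mul_nonneg (by positivity) (pow_nonneg (by linarith) _)
    calc N ^ m * (1 - ε) ^ (m - S.card) ≤
        ((2 / ε) ^ L * (ε / 2) ^ S.card) * (N ^ m * (1 - ε) ^ (m - S.card)) :=
          le_mul_of_one_le_left h5 h4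
      _ = _ := by ring
  calc _ ≤ ((∑ S ∈ (Finset.univ.filter fun S : Finset (Fin m) => S.card ≤ L),
        (G S).card : ℕ) : ℝ) := by exact_mod_cast h2
    _ ≤ ∑ S ∈ (Finset.univ.filter fun S : Finset (Fin m) => S.card ≤ L),
        N ^ m * (2 / ε) ^ L * ((ε / 2) ^ S.card * (1 - ε) ^ (m - S.card)) := by
          push_cast
          exact Finset.sum_le_sum h3
    _ ≤ ∑ S : Finset (Fin m),
        N ^ m * (2 / ε) ^ L * ((ε / 2) ^ S.card * (1 - ε) ^ (m - S.card)) :=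
          Finset.sum_le_sum_of_subset_of_nonneg (Finset.subset_univ _) fun S _ _ =>
            mul_nonneg (by positivity)
              (mul_nonneg (by positivity) (pow_nonneg (by linarith) _))
    _ = N ^ m * ((2 / ε) ^ L * (1 - ε / 2) ^ m) := by
          rw [← Finset.mul_sum, Fin.sum_pow_mul_eq_add_pow]
          ring

/-- A labelling with trivial product on almost all edges is almost constant on every class. -/
theorem exists_majority_labels (hn : 0 < n) {ε δ : ℝ} (hε : k * ε ≤ δ) (hδ : δ + ε ≤ 1)
    (x : Vertex k n → A)
    (hx : (1 - ε) * (n : ℝ) ^ k < (trivialEdges x).ncard) :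
    ∃ a : Fin k → A, ∏ i, a i = 1 ∧ ∃ U : Finset (Vertex k n),
      (U.card : ℝ) ≤ δ * n ∧ ∀ v, v ∈ U ↔ x v ≠ a v.1 := by
  classical
  have hnR : (0 : ℝ) < n := by exact_mod_cast hn
  let f : Edge k n → ℝ := fun e => if edgeProd x e = 1 then 1 else 0
  have hf : ∑ e, f e = (trivialEdges x).ncard := by
    simp only [f, trivialEdges, Set.ncard_eq_toFinset_card']
    simp
  have h1 : ∀ i : Fin k, ∃ a : A,
      (((Finset.univ.filter fun v : Fin n => x ⟨i, v⟩ ≠ a).card : ℕ) : ℝ) ≤ ε * n := by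
    intro i
    by_contra! hcon
    have h2 : ∀ e : Edge k n, ∑ v : Fin n, f (Function.update e i v) ≤ (1 - ε) * n := by
      intro e
      -- With the other coordinates of `e` fixed, exactly one label in class `i` gives a trivial
      -- product. If no label were held by at least (1 - ε)n vertices, averaging over `e` would
      -- leave too few trivial edges.
      have h3 := hcon (∏ j ∈ Finset.univ.erase i, x ⟨j, e j⟩)⁻¹
      have h4 : ∀ v : Fin n, edgeProd x (Function.update e i v) =
          x ⟨i, v⟩ * ∏ j ∈ Finset.univ.erase i, x ⟨j, e j⟩ := by
        intro v
        rw [edgeProd, ← Finset.mul_prod_erase _ _ (Finset.mem_univ i)]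
        congr 1
        · simp
        · refine Finset.prod_congr rfl fun j hj => ?_
          rw [Function.update_of_ne (Finset.ne_of_mem_erase hj)]
      simp only [f, h4, mul_eq_one_iff_eq_inv]
      rw [Finset.sum_boole]
      have h5 := Finset.card_filter_add_card_filter_not (s := (Finset.univ : Finset (Fin n)))
        (fun v => x ⟨i, v⟩ = (∏ j ∈ Finset.univ.erase i, x ⟨j, e j⟩)⁻¹)
      have h6 : (((Finset.univ.filter fun v : Fin n =>
          x ⟨i, v⟩ = (∏ j ∈ Finset.univ.erase i, x ⟨j, e j⟩)⁻¹).card : ℕ) : ℝ) +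
          ((Finset.univ.filter fun v : Fin n =>
          ¬ x ⟨i, v⟩ = (∏ j ∈ Finset.univ.erase i, x ⟨j, e j⟩)⁻¹).card : ℕ) = n := by
        rw [← Nat.cast_add, h5]; simp
      linarith
    have h7 := sum_sum_update i f
    have h8 : ∑ e : Edge k n, ∑ v : Fin n, f (Function.update e i v) ≤
        ∑ _e : Edge k n, (1 - ε) * (n : ℝ) := Finset.sum_le_sum fun e _ => h2 e
    rw [h7, hf] at h8
    simp only [Finset.sum_const, Finset.card_univ, Fintype.card_pi, Fintype.card_fin,
      Finset.prod_const, nsmul_eq_mul, Nat.cast_pow] at h8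
    nlinarith
  choose a ha using h1
  set U := Finset.univ.filter fun v : Vertex k n => x v ≠ a v.1 with hU
  have hUcard : (U.card : ℝ) ≤ k * ε * n := by
    have h2 : U.card = ∑ i : Fin k, (Finset.univ.filter fun v : Fin n => x ⟨i, v⟩ ≠ a i).card := by
      simp only [hU, Finset.card_filter]
      rw [Fintype.sum_sigma]
    rw [h2]
    push_cast
    calc _ ≤ ∑ _i : Fin k, ε * (n : ℝ) := Finset.sum_le_sum fun i _ => ha i
      _ = _ := by simp; ring
  refine ⟨a, ?_, U, hUcard.trans (by gcongr), fun v => by simp [hU]⟩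
  -- If the constants had product ≠ 1, every trivial edge would meet `U`; but only a proportion at
  -- most kε of the edges does, and kε ≤ δ ≤ 1 - ε.
  by_contra hne
  have h3 : ∀ e, f e ≤ hits U e := by
    intro e
    simp only [f]
    split_ifs with h
    · have : 0 < hits U e := by
        by_contra h0
        have h0' : hits U e = 0 := by omega
        rw [hits, Finset.card_eq_zero, Finset.filter_eq_empty_iff] at h0'
        refine hne ?_
        rw [← h, edgeProd]
        refine Finset.prod_congr rfl fun i _ => ?_
        by_contra h4
        exact h0' (x := ⟨i, e i⟩) (by simp only [hU, Finset.mem_filter, Finset.mem_univ, true_and]; exact fun h5 => h4 h5.symm) rfl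
      exact_mod_cast this
    · positivity
  have h4 : ∑ e, f e ≤ ∑ e, (hits U e : ℝ) := Finset.sum_le_sum fun e _ => h3 e
  have h5 := sum_hits U
  have hNpos : (0 : ℝ) < (n : ℝ) ^ k := by positivity
  rw [hf] at h4
  have h6 : (n : ℝ) * ((1 - ε) * (n : ℝ) ^ k) < k * ε * n * (n : ℝ) ^ k := by
    calc (n : ℝ) * ((1 - ε) * (n : ℝ) ^ k) < n * (trivialEdges x).ncard := by gcongr
      _ ≤ n * ∑ e, (hits U e : ℝ) := by gcongr
      _ = U.card * (n : ℝ) ^ k := h5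
      _ ≤ _ := by gcongr
  have h7 : (1 - ε) < k * ε := by
    have : (0 : ℝ) < n * (n : ℝ) ^ k := by positivity
    nlinarith
  linarith

end Spread

/-! ### Stuck sets: exponential moments and the union bound -/

section Stuck

variable {k n : ℕ}

/-- The vertex set `U` is stuck: none of the first `m₀` edges of `s` meets `U` in exactly one
vertex, and every vertex of `U` is on an edge of `s` that contains another vertex of `U`. -/
def Stuck (m₀ : ℕ) (U : Finset (Vertex k n)) {m : ℕ} (s : Fin m → Edge k n) : Prop :=
  (∀ j : Fin m, (j : ℕ) < m₀ → hits U (s j) ≠ 1) ∧ ∀ v ∈ U, ∃ j, s j v.1 = v.2 ∧ 2 ≤ hits U (s j)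

theorem hits_le (U : Finset (Vertex k n)) (e : Edge k n) : hits U e ≤ k := by
  have : hits U e ≤ (Finset.univ : Finset (Fin k)).card := by
    refine Finset.card_le_card_of_injOn (fun v => v.1) (fun _ _ => Finset.mem_univ _) ?_
    rintro ⟨i, a⟩ hv ⟨j, b⟩ hw h
    have h1 := (Finset.mem_filter.1 hv).2
    have h2 := (Finset.mem_filter.1 hw).2
    dsimp only at h h1 h2
    subst h
    rw [← h1, ← h2]
  simpa using this

theorem Stuck.card_le {m₀ m : ℕ} {U : Finset (Vertex k n)} {s : Fin m → Edge k n}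
    (h : Stuck m₀ U s) :
    U.card ≤ k * (Finset.univ.filter fun j => 2 ≤ hits U (s j)).card := by
  classical
  have h1 : U ⊆ (Finset.univ.filter fun j => 2 ≤ hits U (s j)).biUnion
      fun j => U.filter fun v => s j v.1 = v.2 := by
    intro v hv
    obtain ⟨j, hj, hj2⟩ := h.2 v hv
    simp only [Finset.mem_biUnion, Finset.mem_filter, Finset.mem_univ, true_and]
    exact ⟨j, hj2, hv, hj⟩
  calc U.card ≤ _ := Finset.card_le_card h1
    _ ≤ _ := Finset.card_biUnion_le
    _ ≤ ∑ j ∈ Finset.univ.filter fun j => 2 ≤ hits U (s j), k :=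
        Finset.sum_le_sum fun j _ => hits_le U (s j)
    _ = _ := by simp [mul_comm]

open Classical in
-- Exponential Markov: edges meeting `U` at least twice get weight μ^k, and an early edge meeting
-- `U` once gets weight 0. Each edge covers at most k vertices of `U`, so a sequence for which `U`
-- is stuck has weight at least μ^|U|.
theorem card_stuck_le (hn : 0 < n) {m₀ m : ℕ} (hm : m₀ ≤ m) (U : Finset (Vertex k n)) {μ : ℝ}
    (hμ : 1 ≤ μ) :
    μ ^ U.card * ((Finset.univ.filter fun s : Fin m → Edge k n => Stuck m₀ U s).card : ℝ) ≤
      ((n : ℝ) ^ k) ^ m * Real.exp (-(U.card / n * (1 - U.card / n)) * m₀ +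
        (μ ^ k - 1) * (U.card / n) ^ 2 * m) := by
  set N : ℝ := (n : ℝ) ^ k with hN
  set u : ℝ := (U.card : ℝ) with hu
  have hnR : (0 : ℝ) < n := by exact_mod_cast hn
  have hμk : 1 ≤ μ ^ k := one_le_pow₀ hμ
  let g : Fin m → Edge k n → ℝ := fun j e =>
    (if (j : ℕ) < m₀ ∧ hits U e = 1 then 0 else 1) * (if 2 ≤ hits U e then μ ^ k else 1)
  have hg : ∀ j e, 0 ≤ g j e := by
    intro j e
    simp only [g]
    split_ifs <;> simp
    positivity
  have hs1 : ∑ e : Edge k n, (hits U e : ℝ) = N * (u / n) := by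
    have := sum_hits U
    field_simp
    linarith
  have hs2 : ∑ e : Edge k n, (hits U e : ℝ) * (hits U e - 1) ≤ N * (u / n) ^ 2 := by
    have := sum_hits_mul_pred U
    rw [div_pow, ← mul_div_assoc, le_div_iff₀ (by positivity)]
    linarith
  have hcard : ∑ _e : Edge k n, (1 : ℝ) = N := by simp [hN]
  -- For h = `hits U e`, the indicator of h = 1 is at least h - h(h - 1), and that of h ≥ 2 is at
  -- most h(h - 1).
  have hpt : ∀ j e, g j e ≤ 1 - (if (j : ℕ) < m₀ then
      (hits U e : ℝ) - (hits U e : ℝ) * (hits U e - 1) else 0) +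
      (μ ^ k - 1) * ((hits U e : ℝ) * (hits U e - 1)) := by
    intro j e
    simp only [g]
    rcases Nat.lt_or_ge (hits U e) 2 with h | h
    · interval_cases hits U e
      · simp
      · by_cases hj : (j : ℕ) < m₀ <;> simp [hj]
    · have h2 : (2 : ℝ) ≤ hits U e := by exact_mod_cast h
      have h3 : (2 : ℝ) ≤ hits U e * (hits U e - 1) := by nlinarith
      have h4 : (μ ^ k - 1) * 1 ≤ (μ ^ k - 1) * ((hits U e : ℝ) * (hits U e - 1)) := by
        apply mul_le_mul_of_nonneg_left <;> linarith
      have h5 : ¬ hits U e = 1 := by omega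
      simp only [h, h5, and_false, if_true, if_false, one_mul]
      split_ifs <;> nlinarith
  have hsum : ∀ j, ∑ e, g j e ≤ N * Real.exp (-(if (j : ℕ) < m₀ then u / n * (1 - u / n) else 0) +
      (μ ^ k - 1) * (u / n) ^ 2) := by
    intro j
    have h1 : ∑ e, g j e ≤ N * (-(if (j : ℕ) < m₀ then u / n * (1 - u / n) else 0) +
      (μ ^ k - 1) * (u / n) ^ 2 + 1) := by
      refine (Finset.sum_le_sum fun e _ => hpt j e).trans ?_
      rw [Finset.sum_add_distrib, Finset.sum_sub_distrib, hcard, ← Finset.mul_sum]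
      have h2 := mul_le_mul_of_nonneg_left hs2 (by linarith : 0 ≤ μ ^ k - 1)
      split_ifs
      · rw [Finset.sum_sub_distrib, hs1]
        nlinarith
      · simp only [Finset.sum_const_zero]
        nlinarith
    exact h1.trans (mul_le_mul_of_nonneg_left (Real.add_one_le_exp _) (by positivity))
  refine (mul_card_le_prod_sum _ _ g hg ?_).trans
    ((Finset.prod_le_prod (fun j _ => Finset.sum_nonneg fun e _ => hg j e)
      fun j _ => hsum j).trans (le_of_eq ?_))
  · intro s hs
    have hst : Stuck m₀ U s := (Finset.mem_filter.1 hs).2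
    have h1 : ∀ j, g j (s j) = if 2 ≤ hits U (s j) then μ ^ k else 1 := by
      intro j
      simp only [g]
      rw [if_neg (fun h => hst.1 j h.1 h.2), one_mul]
    simp_rw [h1]
    rw [← Finset.prod_filter, Finset.prod_const, ← pow_mul]
    exact pow_le_pow_right₀ hμ hst.card_le
  · rw [Finset.prod_mul_distrib, ← Real.exp_sum, Finset.sum_add_distrib, Finset.sum_neg_distrib,
      ← Finset.sum_filter]
    have h2 : (Finset.univ.filter fun j : Fin m => (j : ℕ) < m₀).card = m₀ := by
      rw [Fin.card_filter_val_lt, min_eq_right hm]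
    simp only [Finset.sum_const, h2, Finset.prod_const, Finset.card_univ, Fintype.card_fin,
      nsmul_eq_mul]
    congr 2
    ring

open Classical in
/-- Union bound over the small vertex sets, with separate bounds below and above size `θ`. -/
theorem card_exists_stuck_le (hn : 0 < n) {m₀ m : ℕ} (hm : m₀ ≤ m) {μ δ θ w w' : ℝ} (hμ : 1 ≤ μ)
    (hw : 0 ≤ w) (hw' : 0 ≤ w')
    (h₁ : ∀ u : ℕ, 1 ≤ u → (u : ℝ) ≤ θ → (u : ℝ) ≤ δ * n →
      Real.exp (-(u / n * (1 - u / n)) * m₀ + (μ ^ k - 1) * (u / n) ^ 2 * m) ≤ (w * μ) ^ u)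
    (h₂ : ∀ u : ℕ, θ < u → (u : ℝ) ≤ δ * n →
      Real.exp (-(u / n * (1 - u / n)) * m₀) ≤ w' ^ u) :
    ((Finset.univ.filter fun s : Fin m → Edge k n => ∃ U : Finset (Vertex k n), U.Nonempty ∧
      (U.card : ℝ) ≤ δ * n ∧ Stuck m₀ U s).card : ℝ) ≤
      ((n : ℝ) ^ k) ^ m * ((Real.exp (k * n * w) - 1) +
        Real.exp (-θ + k * n * (Real.exp 1 * w'))) := by
  set P : ℝ := ((n : ℝ) ^ k) ^ m with hP
  have hP0 : 0 ≤ P := by positivity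
  let G : Finset (Vertex k n) → Finset (Fin m → Edge k n) := fun U =>
    Finset.univ.filter fun s => Stuck m₀ U s
  set I := Finset.univ.filter fun U : Finset (Vertex k n) => U.Nonempty ∧ (U.card : ℝ) ≤ δ * n
  have hsub : (Finset.univ.filter fun s : Fin m → Edge k n => ∃ U : Finset (Vertex k n),
      U.Nonempty ∧ (U.card : ℝ) ≤ δ * n ∧ Stuck m₀ U s) ⊆ I.biUnion G := by
    intro s hs
    obtain ⟨U, h1, h2, h3⟩ := (Finset.mem_filter.1 hs).2
    simp only [I, G, Finset.mem_biUnion, Finset.mem_filter, Finset.mem_univ, true_and]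
    exact ⟨U, ⟨h1, h2⟩, h3⟩
  -- The empty set is given weight 0 here; this produces the `- 1` without which the first term
  -- would not tend to 0.
  have hU : ∀ U ∈ I, ((G U).card : ℝ) ≤ P * ((if U = ∅ then 0 else w ^ U.card) +
      Real.exp (-θ) * (Real.exp 1 * w') ^ U.card) := by
    intro U hU
    obtain ⟨hne, hle⟩ := (Finset.mem_filter.1 hU).2
    rcases le_or_gt (U.card : ℝ) θ with hθ | hθ
    · have h3 := card_stuck_le hn hm U hμ
      have h4 := h₁ U.card hne.card_pos hθ hle
      have h5 : 0 < μ ^ U.card := by positivity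
      have h6 : ((G U).card : ℝ) ≤ P * w ^ U.card := by
        refine le_of_mul_le_mul_left ?_ h5
        calc _ ≤ _ := h3
          _ ≤ P * (w * μ) ^ U.card := mul_le_mul_of_nonneg_left h4 hP0
          _ = _ := by rw [mul_pow]; ring
      rw [if_neg hne.ne_empty]
      refine h6.trans (mul_le_mul_of_nonneg_left ?_ hP0)
      exact le_add_of_nonneg_right (by positivity)
    · have h3 := card_stuck_le hn hm U le_rfl
      have h4 := h₂ U.card hθ hle
      simp only [one_pow, one_mul, sub_self, zero_mul, add_zero] at h3
      refine h3.trans (mul_le_mul_of_nonneg_left (h4.trans ?_) hP0)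
      -- The factor e^(|U| - θ) ≥ 1 lets the sum run over all sets while keeping the gain e^(-θ).
      have h5 : w' ^ U.card ≤ Real.exp (-θ) * (Real.exp 1 * w') ^ U.card := by
        rw [mul_pow, ← Real.exp_nat_mul, ← mul_assoc, ← Real.exp_add]
        refine le_mul_of_one_le_left (by positivity) (Real.one_le_exp ?_)
        linarith
      refine h5.trans (le_add_of_nonneg_left ?_)
      split_ifs <;> positivity
  have hbin : ∀ y : ℝ, 0 ≤ y → ∑ U : Finset (Vertex k n), y ^ U.card ≤ Real.exp (k * n * y) := by
    intro y hy
    have h3 := Fintype.sum_pow_mul_eq_add_pow (Vertex k n) y 1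
    simp only [one_pow, mul_one] at h3
    rw [h3]
    have h4 : Fintype.card (Vertex k n) = k * n := by simp
    rw [h4, ← Nat.cast_mul, Real.exp_nat_mul]
    exact pow_le_pow_left₀ (by positivity) (Real.add_one_le_exp y) _
  calc _ ≤ ((∑ U ∈ I, (G U).card : ℕ) : ℝ) := by
        exact_mod_cast (Finset.card_le_card hsub).trans Finset.card_biUnion_le
    _ ≤ ∑ U ∈ I, P * ((if U = ∅ then 0 else w ^ U.card) +
          Real.exp (-θ) * (Real.exp 1 * w') ^ U.card) := by
        push_cast
        exact Finset.sum_le_sum hU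
    _ ≤ ∑ U : Finset (Vertex k n), P * ((if U = ∅ then 0 else w ^ U.card) +
          Real.exp (-θ) * (Real.exp 1 * w') ^ U.card) := by
        refine Finset.sum_le_sum_of_subset_of_nonneg (Finset.subset_univ _) fun U _ _ => ?_
        split_ifs <;> positivity
    _ ≤ _ := by
        rw [← Finset.mul_sum, Finset.sum_add_distrib, ← Finset.mul_sum]
        refine mul_le_mul_of_nonneg_left (add_le_add ?_ ?_) hP0
        · have h5 := hbin w hw
          rw [← Finset.add_sum_erase _ _ (Finset.mem_univ ∅)] at h5 ⊢
          have h6 : ∀ U ∈ (Finset.univ : Finset (Finset (Vertex k n))).erase ∅,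
              (if U = ∅ then 0 else w ^ U.card) = w ^ U.card := by
            intro U hU
            rw [if_neg (Finset.ne_of_mem_erase hU)]
          rw [Finset.sum_congr rfl h6]
          simp only [Finset.card_empty, pow_zero, if_true] at h5 ⊢
          linarith
        · rw [Real.exp_add]
          exact mul_le_mul_of_nonneg_left (hbin _ (by positivity)) (by positivity)

end Stuck

/-! ### From independent edges to the random ordering -/

section Transfer

open Classical in
-- Two orderings with the same first m values differ by a permutation of the remaining N - m
-- positions.
theorem card_equiv_extending_le {β : Type*} [Fintype β] [DecidableEq β] {N m : ℕ} (hm : m ≤ N)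
    (f : Fin m → β) :
    (Finset.univ.filter fun ω : Fin N ≃ β => (fun j => ω (Fin.castLE hm j)) = f).card ≤
      (N - m).factorial := by
  rcases Finset.eq_empty_or_nonempty
    (Finset.univ.filter fun ω : Fin N ≃ β => (fun j => ω (Fin.castLE hm j)) = f) with h | ⟨ω₀, hω₀⟩
  · simp [h]
  have h0 := (Finset.mem_filter.1 hω₀).2
  have hcard : Fintype.card {σ : Equiv.Perm (Fin N) // ∀ j : Fin N, ¬ (m ≤ (j : ℕ)) → σ j = j} =
      (N - m).factorial := by
    rw [← Fintype.card_congr (Equiv.Perm.subtypeEquivSubtypePerm fun j : Fin N => m ≤ (j : ℕ)),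
      Fintype.card_perm]
    congr 1
    have h1 := Finset.card_filter_add_card_filter_not (s := (Finset.univ : Finset (Fin N)))
      (fun j => (j : ℕ) < m)
    rw [Fin.card_filter_val_lt, min_eq_right hm] at h1
    simp only [not_lt, Finset.card_univ, Fintype.card_fin] at h1
    rw [Fintype.card_subtype]
    omega
  rw [← hcard, ← Fintype.card_coe]
  refine Fintype.card_le_of_injective (fun ω => ⟨ω.1.trans ω₀.symm, fun j hj => ?_⟩) ?_
  · have h1 := (Finset.mem_filter.1 ω.2).2
    have h2 := congrFun (h1.trans h0.symm) ⟨j, by omega⟩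
    have h3 : Fin.castLE hm ⟨j, by omega⟩ = j := rfl
    simp only [h3] at h2
    simp [h2]
  · intro ω ω' h
    have h1 := congrArg Subtype.val h
    ext j
    have h2 := Equiv.congr_fun h1 j
    simpa using h2

variable {k n : ℕ}

/-- The first `m` edges of the random ordering. -/
def initialEdges {m : ℕ} (hm : m ≤ n ^ k) (ω : EdgeOrder k n) : Fin m → Edge k n :=
  fun j => ω (Fin.castLE hm j)

theorem card_initialEdges_le_factorial {m : ℕ} (hm : m ≤ n ^ k) (p : (Fin m → Edge k n) → Prop)
    [DecidablePred p] [DecidablePred fun ω : EdgeOrder k n => p (initialEdges hm ω)] :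
    (Finset.univ.filter fun ω : EdgeOrder k n => p (initialEdges hm ω)).card ≤
      (n ^ k - m).factorial * (Finset.univ.filter fun s => p s).card := by
  generalize hc : (n ^ k - m).factorial = c
  refine Finset.card_le_mul_card_image_of_maps_to (f := initialEdges hm) ?_ _ ?_
  · intro ω hω
    exact Finset.mem_filter.2 ⟨Finset.mem_univ _, (Finset.mem_filter.1 hω).2⟩
  · intro s _
    rw [← hc]
    classical
    have h := card_equiv_extending_le hm s
    refine (Finset.card_le_card ?_).trans h
    intro ω hω
    exact Finset.mem_filter.2 ⟨Finset.mem_univ _, (Finset.mem_filter.1 hω).2⟩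

open Classical in
theorem card_edgeOrder {m : ℕ} (hm : m ≤ n ^ k) :
    Fintype.card (EdgeOrder k n) = (n ^ k - m).factorial * (n ^ k).descFactorial m := by
  rw [Nat.factorial_mul_descFactorial hm, Fintype.card_equiv (finFunctionFinEquiv.symm),
    Fintype.card_fin]

/-- Comparison of the random graph process with independent random edges. -/
theorem card_initialEdges_le {m : ℕ} (hm : m ≤ n ^ k) (hm2 : 2 * m ^ 2 ≤ n ^ k)
    (p : (Fin m → Edge k n) → Prop) [DecidablePred p]
    [DecidablePred fun ω : EdgeOrder k n => p (initialEdges hm ω)] {c : ℝ}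
    (hc : ((Finset.univ.filter fun s => p s).card : ℝ) ≤ ((n : ℝ) ^ k) ^ m * c) :
    ((Finset.univ.filter fun ω : EdgeOrder k n => p (initialEdges hm ω)).card : ℝ) ≤
      2 * c * Fintype.card (EdgeOrder k n) := by
  set B := Finset.univ.filter fun s : Fin m → Edge k n => p s
  -- For m = 0 the number of edges may be 0, and the division by N below would be meaningless.
  rcases Nat.eq_zero_or_pos m with rfl | hmpos
  · have h0 : ∀ ω : EdgeOrder k n, initialEdges hm ω = fun j => j.elim0 := by
      intro ω; ext j; exact j.elim0
    simp_rw [h0]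
    by_cases hp : p fun j => j.elim0
    · have : (1 : ℝ) ≤ B.card := by
        exact_mod_cast Finset.card_pos.2 ⟨_, Finset.mem_filter.2 ⟨Finset.mem_univ _, hp⟩⟩
      simp only [hp, Finset.filter_true, Finset.card_univ]
      simp only [pow_zero, one_mul] at hc
      have : (0 : ℝ) ≤ Fintype.card (EdgeOrder k n) := by positivity
      nlinarith
    · have : (0 : ℝ) ≤ c := by
        simp only [pow_zero, one_mul] at hc
        exact le_trans (by positivity) hc
      simp only [hp, Finset.filter_false, Finset.card_empty, Nat.cast_zero]
      positivity
  obtain ⟨N, hN⟩ : ∃ N, N = n ^ k := ⟨_, rfl⟩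
  have hmN : m ≤ N := hN ▸ hm
  have hmN2 : 2 * m ^ 2 ≤ N := hN ▸ hm2
  have hNpos : 0 < N := lt_of_lt_of_le hmpos hmN
  have hNR : (0 : ℝ) < N := by exact_mod_cast hNpos
  have h1 : (Finset.univ.filter fun ω : EdgeOrder k n => p (initialEdges hm ω)).card ≤
      (N - m).factorial * B.card := by
    rw [hN]
    exact card_initialEdges_le_factorial hm p
  have h2 : Fintype.card (EdgeOrder k n) = (N - m).factorial * N.descFactorial m := by
    rw [hN]
    exact card_edgeOrder hm
  have h3 : (N : ℝ) ^ m ≤ 2 * N.descFactorial m := by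
    have h4 : ((N - m : ℕ) : ℝ) ^ m ≤ N.descFactorial m := by
      exact_mod_cast (Nat.pow_le_pow_left (by omega) m).trans (Nat.pow_sub_le_descFactorial N m)
    have hmR : (m : ℝ) ≤ N := by exact_mod_cast hmN
    -- Bernoulli: (1 - m/N)^m ≥ 1 - m²/N ≥ 1/2, so at least half of all sequences are injective.
    have h5 : 1 + (m : ℝ) * (-(m / N)) ≤ (1 + -((m : ℝ) / N)) ^ m := by
      refine one_add_mul_le_pow ?_ m
      have : (m : ℝ) / N ≤ 1 := by rw [div_le_one hNR]; exact hmR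
      linarith
    have h6 : (m : ℝ) * (m / N) ≤ 1 / 2 := by
      rw [← mul_div_assoc, div_le_div_iff₀ hNR (by norm_num)]
      have : (2 : ℝ) * (m : ℝ) ^ 2 ≤ N := by exact_mod_cast hmN2
      nlinarith
    have h7 : ((N - m : ℕ) : ℝ) = N * (1 + -((m : ℝ) / N)) := by
      rw [Nat.cast_sub hmN]; field_simp; ring
    rw [h7, mul_pow] at h4
    have h8 : (N : ℝ) ^ m * (1 / 2) ≤ (N : ℝ) ^ m * (1 + -((m : ℝ) / N)) ^ m := by
      refine mul_le_mul_of_nonneg_left ?_ (by positivity)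
      linarith
    linarith
  have hNk : ((n : ℝ) ^ k) = N := by rw [hN]; push_cast; rfl
  rw [hNk] at hc
  have hc0 : 0 ≤ c := by
    have : 0 ≤ (N : ℝ) ^ m * c := le_trans (by positivity) hc
    exact nonneg_of_mul_nonneg_right this (by positivity)
  rw [h2]
  generalize (N - m).factorial = c' at h1 ⊢
  have h1' : ((Finset.univ.filter fun ω : EdgeOrder k n => p (initialEdges hm ω)).card : ℝ) ≤
      c' * B.card := by exact_mod_cast h1
  calc _ ≤ (c' : ℝ) * B.card := h1'
    _ ≤ c' * ((N : ℝ) ^ m * c) := by gcongr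
    _ ≤ c' * ((2 * N.descFactorial m) * c) := by gcongr
    _ = _ := by push_cast; ring

end Transfer

/-! ### Deterministic argument at the hitting time -/

section Deterministic

variable {k n : ℕ} {A : Type*} [CommGroup A]

theorem mem_randomGraph {ω : EdgeOrder k n} {m : ℕ} {e : Edge k n} :
    e ∈ randomGraph ω m ↔ ∃ j : Fin (n ^ k), (j : ℕ) < m ∧ ω j = e := by
  simp only [randomGraph, Finset.mem_map, Finset.mem_filter, Finset.mem_univ, true_and,
    Equiv.coe_toEmbedding]

theorem one_le_degree_iff {E : Finset (Edge k n)} {v : Vertex k n} :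
    1 ≤ degree E v ↔ ∃ e ∈ E, e v.1 = v.2 := by
  rw [degree, Nat.one_le_iff_ne_zero, ← Nat.pos_iff_ne_zero, Finset.card_pos]
  simp [Finset.Nonempty]

/-- The property of the random graph at the hitting time that implies global rigidity. -/
def Determined (A : Type*) [CommGroup A] (E : Finset (Edge k n)) : Prop :=
  (∀ v : Vertex k n, ∃ e ∈ E, e v.1 = v.2) ∧
  ∀ x : Vertex k n → A, (∀ e ∈ E, edgeProd x e = 1) →
    ∃ a : Fin k → A, ∏ i, a i = 1 ∧ ∀ v, x v = a v.1

/-- The excluded events involve only the fixed times m₀ ≤ M ≤ m₁. Forbidden edges are sought in the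
first m₀, covering edges in the first m₁, so a bad set at time M is stuck for the pair. -/
theorem determined_hittingTime (hn : 0 < n) {m₀ m₁ : ℕ} (h01 : m₀ ≤ m₁) (h1 : m₁ ≤ n ^ k)
    {ε δ : ℝ} (hε : k * ε ≤ δ) (hδ : δ + ε ≤ 1) (i₀ : Fin k) (ω : EdgeOrder k n)
    (hspread : ¬ ∃ x : Vertex k n → A, (∀ j, edgeProd x (initialEdges (h01.trans h1) ω j) = 1) ∧
      ((trivialEdges x).ncard : ℝ) ≤ (1 - ε) * (n : ℝ) ^ k)
    (hlow : ¬ ∀ a, ¬ Misses (initialEdges (h01.trans h1) ω) ⟨i₀, a⟩)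
    (hhigh : ¬ ∃ v, Misses (initialEdges h1 ω) v)
    (hstuck : ¬ ∃ U : Finset (Vertex k n), U.Nonempty ∧ (U.card : ℝ) ≤ δ * n ∧
      Stuck m₀ U (initialEdges h1 ω)) :
    Determined A (randomGraph ω (hittingTime 1 ω)) := by
  classical
  set S : Set ℕ := {m : ℕ | ∀ v : Vertex k n, 1 ≤ degree (randomGraph ω m) v} with hS
  set M := hittingTime 1 ω with hM
  have hmem1 : m₁ ∈ S := by
    intro v
    rw [one_le_degree_iff]
    by_contra hcon
    refine hhigh ⟨v, fun (j : Fin m₁) hj => hcon ⟨_, mem_randomGraph.2 ⟨Fin.castLE h1 j, j.2, rfl⟩, hj⟩⟩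
  -- Nonemptiness matters: `sInf ∅ = 0` would be a spurious hitting time.
  have hMS : M ∈ S := Nat.sInf_mem ⟨m₁, hmem1⟩
  have hM1 : M ≤ m₁ := Nat.sInf_le hmem1
  have hM0 : m₀ ≤ M := by
    by_contra! hlt
    refine hlow fun a hmiss => ?_
    obtain ⟨e, he, hea⟩ := one_le_degree_iff.1 (hMS ⟨i₀, a⟩)
    obtain ⟨j, hj, rfl⟩ := mem_randomGraph.1 he
    exact hmiss ⟨j, by omega⟩ hea
  refine ⟨fun v => one_le_degree_iff.1 (hMS v), fun x hx => ?_⟩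
  have hgood : (1 - ε) * (n : ℝ) ^ k < (trivialEdges x).ncard := by
    by_contra! hcon
    exact hspread ⟨x, fun j => hx _ (mem_randomGraph.2
      ⟨Fin.castLE (h01.trans h1) j, lt_of_lt_of_le j.2 hM0, rfl⟩), hcon⟩
  obtain ⟨a, ha, U, hUcard, hU⟩ := exists_majority_labels hn hε hδ x hgood
  refine ⟨a, ha, fun v => ?_⟩
  by_contra hv
  -- If w were the only vertex of `U` on e, cancelling the other labels, which are class constants,
  -- would give w its class constant too.
  have hne1 : ∀ e ∈ randomGraph ω M, hits U e ≠ 1 := by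
    intro e he h
    obtain ⟨w, hw⟩ := Finset.card_eq_one.1 h
    have hwmem : w ∈ U.filter fun v => e v.1 = v.2 := by rw [hw]; simp
    obtain ⟨hwU, hwe⟩ := Finset.mem_filter.1 hwmem
    have hprod := (hx e he).trans ha.symm
    rw [edgeProd, ← Finset.mul_prod_erase _ _ (Finset.mem_univ w.1),
      ← Finset.mul_prod_erase _ a (Finset.mem_univ w.1)] at hprod
    have hrest : ∏ i ∈ Finset.univ.erase w.1, x ⟨i, e i⟩ = ∏ i ∈ Finset.univ.erase w.1, a i := by
      refine Finset.prod_congr rfl fun i hi => ?_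
      by_contra hia
      have : (⟨i, e i⟩ : Vertex k n) ∈ U.filter fun v => e v.1 = v.2 :=
        Finset.mem_filter.2 ⟨(hU _).2 hia, rfl⟩
      rw [hw, Finset.mem_singleton] at this
      exact Finset.ne_of_mem_erase hi (by rw [← this])
    rw [hrest, mul_left_inj, hwe] at hprod
    exact (hU w).1 hwU hprod
  refine hstuck ⟨U, ⟨v, (hU v).2 hv⟩, hUcard, fun j hj => ?_, fun w hw => ?_⟩
  · exact hne1 _ (mem_randomGraph.2 ⟨Fin.castLE h1 j, lt_of_lt_of_le hj hM0, rfl⟩)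
  · obtain ⟨e, he, hew⟩ := one_le_degree_iff.1 (hMS w)
    have h3 := hne1 e he
    have h4 : 0 < hits U e := Finset.card_pos.2 ⟨w, Finset.mem_filter.2 ⟨hw, hew⟩⟩
    obtain ⟨j, hj, rfl⟩ := mem_randomGraph.1 he
    exact ⟨⟨j, by omega⟩, hew, by
      have h5 : initialEdges h1 ω ⟨j, by omega⟩ = ω j := rfl
      rw [h5]; omega⟩

end Deterministic

/-! ### Reduction of global rigidity to labellings by units -/

section Rigidity

variable {k n : ℕ}

theorem globallyRigid_of_determined {F : Type*} [Field F] [Algebra ℚ F] {E : Finset (Edge k n)}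
    (h : Determined Fˣ E) : GloballyRigid (V := fun _ : Fin k => Fin n) F 1 E := by
  intro p hp q hpq
  have hp0 : ∀ v, p v 0 ≠ 0 := fun v => hp.ne_zero (v, 0)
  have hprod : ∀ e ∈ E, ∏ i, p ⟨i, e i⟩ 0 = ∏ i, q ⟨i, e i⟩ 0 := by
    intro e he
    simpa [rigidityMap] using congrFun hpq ⟨e, he⟩
  have hq0 : ∀ v, q v 0 ≠ 0 := by
    intro v
    obtain ⟨e, he, hev⟩ := h.1 v
    have h1 : ∏ i, q ⟨i, e i⟩ 0 ≠ 0 := by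
      rw [← hprod e he]
      exact Finset.prod_ne_zero_iff.2 fun i _ => hp0 _
    have h2 := Finset.prod_ne_zero_iff.1 h1 v.1 (Finset.mem_univ _)
    rwa [hev] at h2
  obtain ⟨a, ha, hx⟩ := h.2 (fun v => Units.mk0 (q v 0) (hq0 v) / Units.mk0 (p v 0) (hp0 v)) (by
    intro e he
    rw [edgeProd, Finset.prod_div_distrib, div_eq_one]
    ext
    simpa using (hprod e he).symm)
  -- In dimension 1 the stabilizer is a tuple of scalars and the permutation is trivial.
  refine ⟨fun i => Units.map (Matrix.scalar (Fin 1)).toMonoidHom (a i), ⟨1, fun i _ => a i, ?_, ?_⟩, ?_⟩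
  · intro _
    have := congrArg (Units.val) ha
    simpa using this
  · intro i
    simp
  · intro v
    ext j
    rw [Subsingleton.elim j 0]
    have h1 := congrArg Units.val (hx v)
    simp only [Units.val_div_eq_div_val, Units.val_mk0] at h1
    rw [div_eq_iff (hp0 v)] at h1
    simp [h1, Matrix.mulVec_diagonal]

end Rigidity

/-! ### Choice of constants and asymptotic estimates -/

section Asymptotics

/-- The first threshold, slightly below the expected hitting time. -/
noncomputable def lowerTime (δ : ℝ) (n : ℕ) : ℕ := ⌈(1 - δ) * n * Real.log n⌉₊

/-- The second threshold, above the expected hitting time. -/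
noncomputable def upperTime (n : ℕ) : ℕ := ⌈2 * n * Real.log n⌉₊

variable {k n : ℕ} {δ ε : ℝ}

theorem le_lowerTime : (1 - δ) * n * Real.log n ≤ lowerTime δ n := Nat.le_ceil _

theorem lowerTime_le (hδ : δ ≤ 1) : (lowerTime δ n : ℝ) ≤ (1 - δ) * n * Real.log n + 1 :=
  (Nat.ceil_lt_add_one (mul_nonneg (mul_nonneg (by linarith) (by positivity))
    (Real.log_natCast_nonneg n))).le

theorem le_upperTime : 2 * n * Real.log n ≤ upperTime n := Nat.le_ceil _

theorem upperTime_le (hn : 1 ≤ n) (hL : 1 ≤ Real.log n) :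
    (upperTime n : ℝ) ≤ 3 * n * Real.log n := by
  have h1 : (upperTime n : ℝ) ≤ 2 * n * Real.log n + 1 :=
    (Nat.ceil_lt_add_one (mul_nonneg (by positivity) (Real.log_natCast_nonneg n))).le
  have h2 : (1 : ℝ) ≤ n := by exact_mod_cast hn
  nlinarith

theorem lowerTime_le_upperTime (hδ : 0 ≤ δ) : lowerTime δ n ≤ upperTime n := by
  refine Nat.ceil_mono ?_
  have : 0 ≤ (n : ℝ) * Real.log n := mul_nonneg (by positivity) (Real.log_natCast_nonneg n)
  nlinarith

/-- This is the size comparison that needs k ≥ 3: (n log n)² is below n³ but not below n². -/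
theorem two_mul_upperTime_sq_le (hk : 3 ≤ k) (hn : 1 ≤ n) (hL : 1 ≤ Real.log n)
    (hlog : 18 * Real.log n ^ 2 ≤ n) : 2 * upperTime n ^ 2 ≤ n ^ k := by
  refine le_trans ?_ (Nat.pow_le_pow_right hn hk)
  have h1 := upperTime_le hn hL
  have h2 : 2 * (upperTime n : ℝ) ^ 2 ≤ (n : ℝ) ^ 3 := by
    calc 2 * (upperTime n : ℝ) ^ 2 ≤ 2 * (3 * n * Real.log n) ^ 2 := by gcongr
      _ = (n : ℝ) ^ 2 * (18 * Real.log n ^ 2) := by ring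
      _ ≤ (n : ℝ) ^ 2 * n := by gcongr
      _ = _ := by ring
  exact_mod_cast h2

/-- The O(n) cost of choosing the fresh positions is beaten by a gain of order n log n. -/
theorem spread_bound {K : ℝ} (hε0 : 0 < ε) (hε : ε ≤ 1) (hK0 : 0 ≤ K)
    (hK : K * Real.log (2 / ε) + 1 ≤ ε / 2 * (1 - δ) * Real.log n) :
    (2 / ε) ^ ⌊K * n⌋₊ * (1 - ε / 2) ^ lowerTime δ n ≤ Real.exp (-n) := by
  have hz : 1 ≤ 2 / ε := by rw [le_div_iff₀ hε0]; linarith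
  have h1 : (2 / ε) ^ ⌊K * n⌋₊ ≤ Real.exp (K * n * Real.log (2 / ε)) := by
    rw [← Real.rpow_natCast, Real.rpow_def_of_pos (by positivity), mul_comm]
    refine Real.exp_le_exp.2 (mul_le_mul_of_nonneg_right (Nat.floor_le (by positivity)) ?_)
    exact Real.log_nonneg hz
  have h2 : (1 - ε / 2) ^ lowerTime δ n ≤ Real.exp (-(ε / 2) * ((1 - δ) * n * Real.log n)) := by
    calc (1 - ε / 2) ^ lowerTime δ n ≤ Real.exp (-(ε / 2)) ^ lowerTime δ n :=
          pow_le_pow_left₀ (by linarith) (Real.one_sub_le_exp_neg _) _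
      _ = Real.exp (lowerTime δ n * -(ε / 2)) := (Real.exp_nat_mul _ _).symm
      _ ≤ _ := by
          refine Real.exp_le_exp.2 ?_
          have := le_lowerTime (δ := δ) (n := n)
          nlinarith
  calc _ ≤ Real.exp (K * n * Real.log (2 / ε)) *
        Real.exp (-(ε / 2) * ((1 - δ) * n * Real.log n)) :=
        mul_le_mul h1 h2 (pow_nonneg (by linarith) _) (Real.exp_pos _).le
    _ = Real.exp (n * (K * Real.log (2 / ε) - ε / 2 * (1 - δ) * Real.log n)) := by
        rw [← Real.exp_add]; congr 1; ring
    _ ≤ _ := by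
        refine Real.exp_le_exp.2 ?_
        have : (0 : ℝ) ≤ n := by positivity
        nlinarith

theorem lower_bound (hn : 2 ≤ n) (hδ0 : 0 < δ) (hδ : δ ≤ 1) (hL : 1 ≤ Real.log n)
    (hnδ : 4 / δ ≤ n) :
    Real.exp (δ / 2 * Real.log n) ≤ n * (1 - 1 / n : ℝ) ^ lowerTime δ n := by
  have hnR : (2 : ℝ) ≤ n := by exact_mod_cast hn
  have hb : 0 < 1 - 1 / (n : ℝ) := by
    rw [sub_pos, div_lt_one (by linarith)]; linarith
  have h1 : -(1 / ((n : ℝ) - 1)) ≤ Real.log (1 - 1 / n) := by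
    have h2 := Real.one_sub_inv_le_log_of_pos hb
    refine le_trans (le_of_eq ?_) h2
    have h3 : (n : ℝ) - 1 ≠ 0 := by linarith
    have h4 : (n : ℝ) ≠ 0 := by linarith
    have h5 : 1 - 1 / (n : ℝ) = (n - 1) / n := by field_simp
    rw [h5, inv_div]
    field_simp
    ring
  have h6 : (lowerTime δ n : ℝ) * (1 / ((n : ℝ) - 1)) ≤ (1 - δ / 2) * Real.log n := by
    -- The slack between 1 - δ and 1 - δ/2 absorbs both the ceiling and the denominator n - 1; this
    -- is where 4/δ ≤ n enters.
    rw [mul_one_div, div_le_iff₀ (by linarith)]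
    refine (lowerTime_le hδ).trans ?_
    rw [div_le_iff₀ hδ0] at hnδ
    nlinarith
  calc Real.exp (δ / 2 * Real.log n) = n * Real.exp (-((1 - δ / 2) * Real.log n)) := by
        nth_rewrite 2 [← Real.exp_log (by linarith : (0 : ℝ) < n)]
        rw [← Real.exp_add]; congr 1; ring
    _ ≤ n * Real.exp (lowerTime δ n * Real.log (1 - 1 / n)) := by
        gcongr
        have h7 := mul_le_mul_of_nonneg_left h1 (by positivity : (0 : ℝ) ≤ lowerTime δ n)
        linarith
    _ = _ := by rw [Real.exp_nat_mul, Real.exp_log hb]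

theorem upper_bound (hn : 1 ≤ n) :
    (n : ℝ) * k * (1 - 1 / n) ^ upperTime n ≤ k * Real.exp (-Real.log n) := by
  have hnR : (1 : ℝ) ≤ n := by exact_mod_cast hn
  have h1 : (1 - 1 / (n : ℝ)) ^ upperTime n ≤ Real.exp (-(2 * Real.log n)) := by
    calc (1 - 1 / (n : ℝ)) ^ upperTime n ≤ Real.exp (-(1 / n)) ^ upperTime n := by
          refine pow_le_pow_left₀ ?_ (Real.one_sub_le_exp_neg _) _
          rw [sub_nonneg, div_le_one (by linarith)]; exact hnR
      _ = Real.exp (upperTime n * -(1 / n)) := (Real.exp_nat_mul _ _).symm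
      _ ≤ _ := by
          refine Real.exp_le_exp.2 ?_
          have h2 := le_upperTime (n := n)
          rw [mul_neg, neg_le_neg_iff, mul_one_div, le_div_iff₀ (by linarith)]
          linarith
  calc _ ≤ (n : ℝ) * k * Real.exp (-(2 * Real.log n)) := by gcongr
    _ = k * (n * Real.exp (-(2 * Real.log n))) := by ring
    _ = _ := by
        nth_rewrite 1 [← Real.exp_log (by linarith : (0 : ℝ) < n)]
        rw [← Real.exp_add]; congr 2; ring

open Classical in
-- As m₀ < n log n, avoiding single hits gives only n^(-(1 - 2δ)) per vertex, not enough against the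
-- kn choices of a vertex. For small sets the covering condition supplies a further factor 1/μ. For
-- large sets, the sum over sets costs exp(O(n^(2δ))), which e^(-θ) with θ of order √n absorbs.
theorem stuck_bound (hk : 0 < k) (hn : 1 ≤ n) (hL : 1 ≤ Real.log n)
    (hδ : δ = 1 / (16 * k))
    (hE : k * Real.exp 1 + 1 ≤ 1 / (24 * k) * Real.exp (Real.log n / 4)) :
    ((Finset.univ.filter fun s : Fin (upperTime n) → Edge k n => ∃ U : Finset (Vertex k n),
      U.Nonempty ∧ (U.card : ℝ) ≤ δ * n ∧ Stuck (lowerTime δ n) U s).card : ℝ) ≤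
      ((n : ℝ) ^ k) ^ upperTime n *
        ((Real.exp (k * Real.exp (-(Real.log n / (4 * k)))) - 1) +
          Real.exp (-Real.exp (Real.log n / 4))) := by
  set L := Real.log n with hLdef
  have hnR : (1 : ℝ) ≤ n := by exact_mod_cast hn
  have hkR : (1 : ℝ) ≤ k := by exact_mod_cast hk
  have hnL : (n : ℝ) = Real.exp L := (Real.exp_log (by linarith)).symm
  have hδ0 : 0 < δ := by rw [hδ]; positivity
  have hδ1 : δ ≤ 1 / 16 := by
    rw [hδ, div_le_div_iff₀ (by positivity) (by norm_num)]; linarith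
  have hm0 := le_lowerTime (δ := δ) (n := n)
  have hm1 := upperTime_le hn hL
  rw [← hLdef] at hm0 hm1
  have hmain : ∀ u : ℕ, (u : ℝ) ≤ δ * n →
      -(u / n * (1 - u / n)) * (lowerTime δ n : ℝ) ≤ -(u * ((1 - 2 * δ) * L)) := by
    intro u hu
    have h1 : (u : ℝ) / n ≤ δ := by rwa [div_le_iff₀ (by linarith)]
    have h2 : (u : ℝ) * ((1 - 2 * δ) * L) ≤ u / n * (1 - u / n) * ((1 - δ) * n * L) := by
      have h3 : (u : ℝ) / n * (1 - u / n) * ((1 - δ) * n * L) =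
          u * ((1 - u / n) * (1 - δ) * L) := by field_simp
      rw [h3]
      gcongr
      nlinarith
    have h4 : (u : ℝ) / n * (1 - u / n) * ((1 - δ) * n * L) ≤
        u / n * (1 - u / n) * lowerTime δ n := by
      refine mul_le_mul_of_nonneg_left hm0 (mul_nonneg (by positivity) (by linarith))
    linarith
  have hμk : Real.exp (L / (2 * k)) ^ k = Real.exp (L / 2) := by
    rw [← Real.exp_nat_mul]; congr 1; field_simp
  -- Here μ^k = √n, and u ≤ θ = √n/(24k) keeps the second-moment term below u·L/(8k). With 2δ =
  -- 1/(8k) the total loss is L/(4k) per vertex against a gain log μ = L/(2k), so w = n^(-1 -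
  -- 1/(4k)) and nw → 0.
  have key := card_exists_stuck_le (k := k) (n := n) (m₀ := lowerTime δ n) (m := upperTime n)
    (μ := Real.exp (L / (2 * k))) (δ := δ) (θ := 1 / (24 * k) * Real.exp (L / 2))
    (w := Real.exp (-(L * (1 + 1 / (4 * k))))) (w' := Real.exp (-((1 - 2 * δ) * L)))
    hn (lowerTime_le_upperTime hδ0.le) (Real.one_le_exp (by positivity))
    (Real.exp_pos _).le (Real.exp_pos _).le ?_ ?_
  · refine key.trans (mul_le_mul_of_nonneg_left (add_le_add (sub_le_sub_right ?_ _) ?_)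
      (by positivity))
    · refine Real.exp_le_exp.2 (le_of_eq ?_)
      rw [mul_assoc]
      nth_rewrite 1 [hnL]
      rw [← Real.exp_add]
      congr 2
      ring
    · refine Real.exp_le_exp.2 ?_
      have h1 : (n : ℝ) * Real.exp (-((1 - 2 * δ) * L)) ≤ Real.exp (L / 4) := by
        rw [hnL, ← Real.exp_add]
        refine Real.exp_le_exp.2 ?_
        nlinarith
      have h2 : Real.exp (L / 2) = Real.exp (L / 4) * Real.exp (L / 4) := by
        rw [← Real.exp_add]; congr 1; ring
      have h3 : (k : ℝ) * n * (Real.exp 1 * Real.exp (-((1 - 2 * δ) * L))) ≤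
          k * Real.exp 1 * Real.exp (L / 4) := by
        calc _ = k * Real.exp 1 * (n * Real.exp (-((1 - 2 * δ) * L))) := by ring
          _ ≤ _ := by gcongr
      have h4 := mul_le_mul_of_nonneg_right hE (Real.exp_pos (L / 4)).le
      rw [h2]
      nlinarith
  · intro u _ hθ hu
    rw [← Real.exp_add, ← Real.exp_nat_mul _ u]
    refine Real.exp_le_exp.2 ?_
    have h1 := hmain u hu
    have hx : Real.exp (L / 2) * Real.exp (L / 2) = n := by
      rw [hnL, ← Real.exp_add]; congr 1; ring
    have h3 : Real.exp (L / 2) * u / n ≤ 1 / (24 * k) := by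
      rw [div_le_iff₀ (by linarith), ← hx]
      calc Real.exp (L / 2) * u ≤ Real.exp (L / 2) * (1 / (24 * k) * Real.exp (L / 2)) := by
            gcongr
        _ = _ := by ring
    have h2 : (Real.exp (L / (2 * k)) ^ k - 1) * ((u : ℝ) / n) ^ 2 * upperTime n ≤
        u * (3 * (1 / (24 * k)) * L) := by
      rw [hμk]
      calc (Real.exp (L / 2) - 1) * ((u : ℝ) / n) ^ 2 * upperTime n
          ≤ Real.exp (L / 2) * ((u : ℝ) / n) ^ 2 * (3 * n * L) := by
            gcongr
            linarith
        _ = u * (3 * (Real.exp (L / 2) * u / n) * L) := by field_simp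
        _ ≤ u * (3 * (1 / (24 * k)) * L) := by gcongr
    calc _ ≤ -(u * ((1 - 2 * δ) * L)) + u * (3 * (1 / (24 * k)) * L) := add_le_add h1 h2
      _ = _ := by rw [hδ]; field_simp; ring
  · intro u _ hu
    rw [← Real.exp_nat_mul]
    refine Real.exp_le_exp.2 ((hmain u hu).trans (le_of_eq ?_))
    ring

/-- An upper bound for the probability that the random graph at the hitting time does not
determine the labels. -/
noncomputable def failureBound (k : ℕ) (δ L : ℝ) : ℝ :=
  Real.exp (-Real.exp L) + Real.exp (-(δ / 2 * L)) + k * Real.exp (-L) +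
    ((Real.exp (k * Real.exp (-(L / (4 * k)))) - 1) + Real.exp (-Real.exp (L / 4)))

theorem tendsto_failureBound (hk : 0 < k) (hδ : 0 < δ) :
    Filter.Tendsto (failureBound k δ) Filter.atTop (𝓝 0) := by
  have hneg : ∀ c : ℝ, 0 < c → Filter.Tendsto (fun L : ℝ => Real.exp (-(c * L))) Filter.atTop
      (𝓝 0) := fun c hc => Real.tendsto_exp_neg_atTop_nhds_zero.comp
        (Filter.Tendsto.const_mul_atTop hc Filter.tendsto_id)
  have h1 : Filter.Tendsto (fun L => Real.exp (-Real.exp L)) Filter.atTop (𝓝 0) :=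
    Real.tendsto_exp_neg_atTop_nhds_zero.comp Real.tendsto_exp_atTop
  have h2 : Filter.Tendsto (fun L => Real.exp (-Real.exp (L / 4))) Filter.atTop (𝓝 0) :=
    h1.comp (Filter.tendsto_id.atTop_div_const (by norm_num : (0 : ℝ) < 4))
  have hkR : (0 : ℝ) < k := by exact_mod_cast hk
  have h3 : Filter.Tendsto (fun L : ℝ => Real.exp (k * Real.exp (-(L / (4 * k)))) - 1)
      Filter.atTop (𝓝 0) := by
    have h4 := (hneg (1 / (4 * k)) (by positivity)).const_mul (k : ℝ)
    have h5 := (Real.continuous_exp.tendsto _).comp h4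
    have h6 := h5.sub_const 1
    simp only [mul_zero, Real.exp_zero, sub_self] at h6
    refine h6.congr fun L => ?_
    simp only [Function.comp]
    congr 5
    ring
  have h7 := ((h1.add (hneg (δ / 2) (by positivity))).add
    (Real.tendsto_exp_neg_atTop_nhds_zero.const_mul (k : ℝ))).add (h3.add h2)
  simp only [mul_zero, add_zero] at h7
  exact h7

open Classical in
theorem card_not_determined_le_of_bounds (A : Type*) [CommGroup A] (hk : 0 < k) (hn : 0 < n)
    {m₀ m₁ : ℕ} (h01 : m₀ ≤ m₁) (hm : m₁ ≤ n ^ k) (hm2 : 2 * m₁ ^ 2 ≤ n ^ k)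
    (hε : k * ε ≤ δ) (hδ : δ + ε ≤ 1) {c₁ c₂ c₃ c₄ : ℝ}
    (h₁ : ((Finset.univ.filter fun s : Fin m₀ → Edge k n => ∃ x : Vertex k n → A,
      (∀ j, edgeProd x (s j) = 1) ∧
        ((trivialEdges x).ncard : ℝ) ≤ (1 - ε) * (n : ℝ) ^ k).card : ℝ) ≤ ((n : ℝ) ^ k) ^ m₀ * c₁)
    (h₂ : ((Finset.univ.filter fun s : Fin m₀ → Edge k n =>
      ∀ a, ¬ Misses s ⟨⟨0, hk⟩, a⟩).card : ℝ) ≤ ((n : ℝ) ^ k) ^ m₀ * c₂)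
    (h₃ : ((Finset.univ.filter fun s : Fin m₁ → Edge k n => ∃ v, Misses s v).card : ℝ) ≤
      ((n : ℝ) ^ k) ^ m₁ * c₃)
    (h₄ : ((Finset.univ.filter fun s : Fin m₁ → Edge k n => ∃ U : Finset (Vertex k n),
      U.Nonempty ∧ (U.card : ℝ) ≤ δ * n ∧ Stuck m₀ U s).card : ℝ) ≤ ((n : ℝ) ^ k) ^ m₁ * c₄) :
    ((Finset.univ.filter fun ω : EdgeOrder k n =>
      ¬ Determined A (randomGraph ω (hittingTime 1 ω))).card : ℝ) ≤
      2 * (c₁ + c₂ + c₃ + c₄) * Fintype.card (EdgeOrder k n) := by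
  have hm02 : 2 * m₀ ^ 2 ≤ n ^ k :=
    le_trans (Nat.mul_le_mul_left 2 (Nat.pow_le_pow_left h01 2)) hm2
  have b1 := card_initialEdges_le (h01.trans hm) hm02 (fun s => ∃ x : Vertex k n → A,
    (∀ j, edgeProd x (s j) = 1) ∧ ((trivialEdges x).ncard : ℝ) ≤ (1 - ε) * (n : ℝ) ^ k) h₁
  have b2 := card_initialEdges_le (h01.trans hm) hm02 (fun s => ∀ a, ¬ Misses s ⟨⟨0, hk⟩, a⟩) h₂
  have b3 := card_initialEdges_le hm hm2 (fun s => ∃ v, Misses s v) h₃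
  have b4 := card_initialEdges_le hm hm2 (fun s => ∃ U : Finset (Vertex k n),
    U.Nonempty ∧ (U.card : ℝ) ≤ δ * n ∧ Stuck m₀ U s) h₄
  have hsub : (Finset.univ.filter fun ω : EdgeOrder k n =>
      ¬ Determined A (randomGraph ω (hittingTime 1 ω))) ⊆
      (((Finset.univ.filter fun ω : EdgeOrder k n => ∃ x : Vertex k n → A,
        (∀ j, edgeProd x (initialEdges (h01.trans hm) ω j) = 1) ∧
        ((trivialEdges x).ncard : ℝ) ≤ (1 - ε) * (n : ℝ) ^ k) ∪
      (Finset.univ.filter fun ω : EdgeOrder k n =>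
        ∀ a, ¬ Misses (initialEdges (h01.trans hm) ω) ⟨⟨0, hk⟩, a⟩)) ∪
      (Finset.univ.filter fun ω : EdgeOrder k n => ∃ v, Misses (initialEdges hm ω) v)) ∪
      (Finset.univ.filter fun ω : EdgeOrder k n => ∃ U : Finset (Vertex k n),
        U.Nonempty ∧ (U.card : ℝ) ≤ δ * n ∧ Stuck m₀ U (initialEdges hm ω)) := by
    intro ω hω
    by_contra hcon
    simp only [Finset.mem_union, Finset.mem_filter, Finset.mem_univ, true_and, not_or] at hcon
    exact (Finset.mem_filter.1 hω).2 (determined_hittingTime hn h01 hm hε hδ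
      ⟨0, hk⟩ ω hcon.1.1.1 hcon.1.1.2 hcon.1.2 hcon.2)
  have hcard := (Finset.card_le_card hsub).trans ((Finset.card_union_le _ _).trans
    (Nat.add_le_add_right ((Finset.card_union_le _ _).trans
      (Nat.add_le_add_right (Finset.card_union_le _ _) _)) _))
  have hcardR := (Nat.cast_le (α := ℝ)).2 hcard
  rw [Nat.cast_add, Nat.cast_add, Nat.cast_add] at hcardR
  refine hcardR.trans (le_trans (add_le_add (add_le_add (add_le_add b1 b2) b3) b4) (le_of_eq ?_))
  ring

open Classical in
theorem card_not_determined_le (A : Type*) [CommGroup A] (hk : 3 ≤ k) (hn : 2 ≤ n)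
    (hδ : δ = 1 / (16 * k)) (hε : ε = δ / k)
    (hL : 1 ≤ Real.log n) (hnδ : 4 / δ ≤ n) (hlog : 18 * Real.log n ^ 2 ≤ n)
    (hK : 4 * k * Real.log (4 * k) * Real.log (2 / ε) + 1 ≤ ε / 2 * (1 - δ) * Real.log n)
    (hE : k * Real.exp 1 + 1 ≤ 1 / (24 * k) * Real.exp (Real.log n / 4)) :
    ((Finset.univ.filter fun ω : EdgeOrder k n =>
      ¬ Determined A (randomGraph ω (hittingTime 1 ω))).card : ℝ) ≤
      2 * failureBound k δ (Real.log n) * Fintype.card (EdgeOrder k n) := by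
  have hkR : (3 : ℝ) ≤ k := by exact_mod_cast hk
  have hnR : (2 : ℝ) ≤ n := by exact_mod_cast hn
  have hδ0 : 0 < δ := by rw [hδ]; positivity
  have hδ1 : δ ≤ 1 / 16 := by
    rw [hδ, div_le_div_iff₀ (by positivity) (by norm_num)]; linarith
  have hε0 : 0 < ε := by rw [hε]; positivity
  have hεδ : k * ε ≤ δ := by rw [hε]; field_simp; rfl
  have hεle : ε ≤ δ := by nlinarith
  have h01 : lowerTime δ n ≤ upperTime n := lowerTime_le_upperTime hδ0.le
  have hm1sq := two_mul_upperTime_sq_le hk (by omega) hL hlog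
  have h1 : upperTime n ≤ n ^ k := by
    have := Nat.le_self_pow two_ne_zero (upperTime n)
    omega
  have hP : ∀ m : ℕ, (0 : ℝ) ≤ ((n : ℝ) ^ k) ^ m := fun m => by positivity
  have hnexp : Real.exp (Real.log n) = n := Real.exp_log (by linarith)
  refine card_not_determined_le_of_bounds A (by omega) (by omega) h01 h1 hm1sq hεδ (by linarith)
    ?_ ?_ ?_ (stuck_bound (by omega) (by omega) hL hδ hE)
  · refine (card_spread_le (by omega) hε0 (by linarith) _).trans
      (mul_le_mul_of_nonneg_left ?_ (hP _))
    rw [hnexp]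
    refine spread_bound hε0 (by linarith) ?_ hK
    exact mul_nonneg (by positivity) (Real.log_nonneg (by linarith))
  · have h2 := card_covers_class_le hn (lowerTime δ n) (⟨0, by omega⟩ : Fin k)
    have h3 := lower_bound hn hδ0 (by linarith) hL hnδ
    rw [Real.exp_neg, ← div_eq_mul_inv, le_div_iff₀ (Real.exp_pos _)]
    refine le_trans ?_ h2
    refine (mul_le_mul_of_nonneg_left h3 (by positivity)).trans (le_of_eq ?_)
    congr!
  · refine le_trans (le_of_eq ?_) ((card_exists_misses_le (by omega) _).trans
      (mul_le_mul_of_nonneg_left (upper_bound (by omega)) (hP _)))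
    congr!

end Asymptotics

/-! ### Probabilities and the limit -/

section Limit

open Classical in
theorem processMeasure_eq {k n : ℕ} (p : EdgeOrder k n → Prop) :
    processMeasure k n {ω | p ω} = ENNReal.ofReal
      ((Finset.univ.filter fun ω => p ω).card / Fintype.card (EdgeOrder k n)) := by
  have hpos : 0 < Fintype.card (EdgeOrder k n) := by
    have : Nonempty (EdgeOrder k n) := ⟨finFunctionFinEquiv.symm⟩
    exact Fintype.card_pos
  rw [processMeasure, ProbabilityTheory.uniformOn_univ,
    ENNReal.ofReal_div_of_pos (by exact_mod_cast hpos), ENNReal.ofReal_natCast,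
    ENNReal.ofReal_natCast]
  congr 1
  rw [← MeasureTheory.Measure.count_apply_finset]
  simp

theorem tendsto_determined (k : ℕ) (hk : 3 ≤ k) (A : Type*) [CommGroup A] :
    Filter.Tendsto (fun n : ℕ => processMeasure k n
      {ω | Determined A (randomGraph ω (hittingTime 1 ω))}) Filter.atTop (𝓝 1) := by
  classical
  have hkR : (3 : ℝ) ≤ k := by exact_mod_cast hk
  set δ : ℝ := 1 / (16 * k) with hδ
  set ε : ℝ := δ / k with hε
  have hδ0 : 0 < δ := by positivity
  have hδ1 : δ ≤ 1 / 16 := by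
    rw [hδ, div_le_div_iff₀ (by positivity) (by norm_num)]; linarith
  have hε0 : 0 < ε := by positivity
  have hcast : Filter.Tendsto (fun n : ℕ => (n : ℝ)) Filter.atTop Filter.atTop :=
    tendsto_natCast_atTop_atTop
  have hlogt : Filter.Tendsto (fun n : ℕ => Real.log n) Filter.atTop Filter.atTop :=
    Real.tendsto_log_atTop.comp hcast
  have hlower : Filter.Tendsto (fun n : ℕ => ENNReal.ofReal
      (1 - 2 * failureBound k δ (Real.log n))) Filter.atTop (𝓝 1) := by
    have h1 := ((tendsto_failureBound (k := k) (by omega) hδ0).comp hlogt).const_mul 2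
    have h2 := ENNReal.tendsto_ofReal (h1.const_sub 1)
    simpa using h2
  refine tendsto_of_tendsto_of_tendsto_of_le_of_le' hlower tendsto_const_nhds ?_ ?_
  · have e1 := hcast.eventually_ge_atTop (4 / δ)
    have e2 := hlogt.eventually_ge_atTop 1
    have e3 : ∀ᶠ n : ℕ in Filter.atTop, 18 * Real.log n ^ 2 ≤ n := by
      have h1 := hcast.eventually ((Real.isLittleO_pow_log_id_atTop (n := 2)).bound
        (by norm_num : (0 : ℝ) < 1 / 18))
      filter_upwards [h1] with n hn
      simp only [id, Real.norm_eq_abs, abs_of_nonneg (sq_nonneg (Real.log (n : ℝ))),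
        Nat.abs_cast] at hn
      linarith
    have e4 := (hlogt.const_mul_atTop (by nlinarith : 0 < ε / 2 * (1 - δ))).eventually_ge_atTop
      (4 * k * Real.log (4 * k) * Real.log (2 / ε) + 1)
    have e5 := ((Real.tendsto_exp_atTop.comp (hlogt.atTop_div_const
      (by norm_num : (0 : ℝ) < 4))).const_mul_atTop
        (by positivity : (0 : ℝ) < 1 / (24 * k))).eventually_ge_atTop (k * Real.exp 1 + 1)
    filter_upwards [e1, e2, e3, e4, e5, Filter.eventually_ge_atTop 2] with n h1 h2 h3 h4 h5 hn
    have hmain := card_not_determined_le A hk hn hδ hε h2 h1 h3 h4 h5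
    rw [processMeasure_eq]
    refine ENNReal.ofReal_le_ofReal ?_
    have hpos : (0 : ℝ) < Fintype.card (EdgeOrder k n) := by
      have : Nonempty (EdgeOrder k n) := ⟨finFunctionFinEquiv.symm⟩
      exact_mod_cast Fintype.card_pos
    rw [le_div_iff₀ hpos]
    have hsplit := Finset.card_filter_add_card_filter_not (s := (Finset.univ : Finset (EdgeOrder k n)))
      (fun ω => Determined A (randomGraph ω (hittingTime 1 ω)))
    have hsplitR := congrArg (Nat.cast (R := ℝ)) hsplit
    push_cast at hsplitR
    rw [Finset.card_univ] at hsplitR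
    linarith
  · refine Filter.Eventually.of_forall fun n => ?_
    have : Nonempty (EdgeOrder k n) := ⟨finFunctionFinEquiv.symm⟩
    have : MeasureTheory.IsProbabilityMeasure (processMeasure k n) := by
      rw [processMeasure]
      infer_instance
    exact MeasureTheory.prob_le_one

theorem tendsto_globallyRigid (k : ℕ) (hk : 3 ≤ k) (F : Type*) [Field F] [Algebra ℚ F] :
    Filter.Tendsto (fun n : ℕ => processMeasure k n
      {ω | GloballyRigid F 1 (randomGraph ω (hittingTime 1 ω))}) Filter.atTop (𝓝 1) := by
  refine tendsto_of_tendsto_of_tendsto_of_le_of_le (tendsto_determined k hk Fˣ)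
    tendsto_const_nhds (fun n => ?_) fun n => ?_
  · exact MeasureTheory.measure_mono fun ω hω => globallyRigid_of_determined hω
  · have : Nonempty (EdgeOrder k n) := ⟨finFunctionFinEquiv.symm⟩
    have : MeasureTheory.IsProbabilityMeasure (processMeasure k n) := by
      rw [processMeasure]
      infer_instance
    exact MeasureTheory.prob_le_one

end Limit

end TensorRigidity

theorem mainTheorem6 (k : ℕ) (hk : 3 ≤ k) :
    Filter.Tendsto
      (fun n : ℕ => TensorRigidity.processMeasure k n
        {ω | TensorRigidity.GloballyRigid ℝ 1
          (TensorRigidity.randomGraph ω (TensorRigidity.hittingTime 1 ω))})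
      Filter.atTop (nhds 1) ∧
    Filter.Tendsto
      (fun n : ℕ => TensorRigidity.processMeasure k n
        {ω | TensorRigidity.GloballyRigid ℂ 1
          (TensorRigidity.randomGraph ω (TensorRigidity.hittingTime 1 ω))})
      Filter.atTop (nhds 1) :=
  ⟨TensorRigidity.tendsto_globallyRigid k hk ℝ, TensorRigidity.tendsto_globallyRigid k hk ℂ⟩
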